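/- All manifolds are smooth, real, finite-dimensional, without boundary, Hausdorff and second countable. Let $L\to M$ be a smooth real line bundle and let $\Gamma(L)$ be its space of smooth sections. A \emph{derivation} of $L$ is an $\mathbb R$-linear map $D:\Gamma(L)\to\Gamma(L)$ such that, for some vector field $X$ on $M$, $D(f\lambda)=X(f)\lambda+fD(\lambda)$ for all $f\in C^\infty(M)$, $\lambda\in\Gamma(L)$. A \emph{Jacobi bracket} on $L$ is a Lie bracket $\{-,-\}$ on the real vector space $\Gamma(L)$ that is a derivation in each argument. A \emph{Jacobi manifold} is a manifold $M$ with a line bundle $L\to M$ and a Jacobi bracket on $L$. A \emph{Jacobi map} $(L_1\to M_1,\{-,-\}_1)\to(L_2\to M_2,\{-,-\}_2)$ is a smooth vector bundle map $F:L_1\to L_2$, covering a smooth map $\varphi:M_1\to M_2$ and invertible on each fibre, such that $\{F^*\lambda,F^*\mu\}_1=F^*\{\lambda,\mu\}_2$ for all $\lambda,\mu\in\Gamma(L_2)$, where $(F^*\lambda)_x=F_x^{-1}(\lambda_{\varphi(x)})$. A \emph{homogeneous manifold} is a principal $\mathbb R^*$-bundle $P\to M$, where $\mathbb R^*=\mathbb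 R\smallsetminus\{0\}$; write $h_t:P\to P$ for the action of $t\in\mathbb R^*$. A \emph{homogeneous Poisson manifold} is a homogeneous manifold $P$ with a Poisson bracket $\{-,-\}_P$ on $C^\infty(P)$ that is homogeneous of degree $-1$: $h_t^*\{f,g\}_P=t^{-1}\{h_t^*f,h_t^*g\}_P$ for all $t\in\mathbb R^*$ and $f,g\in C^\infty(P)$. Their morphisms are the smooth $\mathbb R^*$-equivariant Poisson maps. For a line bundle $L\to M$ let $\widetilde L:=L^*\smallsetminus 0$ be the complement of the zero section of the dual bundle, a principal $\mathbb R^*$-bundle over $M$ under scalar multiplication; for $\lambda\in\Gamma(L)$ let $\widetilde\lambda\in C^\infty(\widetilde L)$ be given by $\widetilde\lambda(\varepsilon)=\langle\varepsilon,\lambda_x\rangle$ for $\varepsilon\in L_x^*\smallsetminus 0$. \textbf{Theorem.} (1) Let $L\to M$ be a line bundle. For every Jacobi bracket $\{-,-\}$ on $L$ there is a unique Poisson bracket $\{-,-\}_{\widetilde L}$ on $\widetilde L$ such that $$\{\widetilde\lambda,\widetilde\mu\}_{\widetilde L}=\widetilde{\{\lambda,\mu\}}\qquad\text{for all }\lambda,\mu\in\Gamma(L).$$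 It is homogeneous of degree $-1$, and the assignment $\{-,-\}\mapsto\{-,-\}_{\widetilde L}$ is a bijection between the Jacobi brackets on $L$ and the Poisson brackets on $\widetilde L$ that are homogeneous of degree $-1$. (2) If $F:L_1\to L_2$ is a Jacobi map, then $\widetilde F:\widetilde L_1\to\widetilde L_2$, $\widetilde F(\varepsilon)=\varepsilon\circ F_x^{-1}$ for $\varepsilon\in (L_1)_x^*\smallsetminus 0$, is an $\mathbb R^*$-equivariant Poisson map, and the functor $(L,\{-,-\})\mapsto(\widetilde L,\{-,-\}_{\widetilde L})$, $F\mapsto\widetilde F$, is an equivalence from the category of Jacobi manifolds and Jacobi maps to the category of homogeneous Poisson manifolds and $\mathbb R^*$-equivariant Poisson maps. -/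

import Mathlib

open Bundle
open scoped Manifold ContDiff Topology

set_option linter.unusedSectionVars false

noncomputable section

section LineBundleFacts

variable {E H M : Type} [NormedAddCommGroup E] [NormedSpace ℝ E] [TopologicalSpace H]
  {I : ModelWithCorners ℝ E H} [TopologicalSpace M] [ChartedSpace H M]
  (L : M → Type) [∀ x, AddCommGroup (L x)] [∀ x, Module ℝ (L x)]
  [∀ x, TopologicalSpace (L x)] [TopologicalSpace (TotalSpace ℝ L)]
  [FiberBundle ℝ L] [VectorBundle ℝ ℝ L]

/-- The fibres of the dual line bundle `L^*`. -/
abbrev DualFiber (x : M) : Type := L x →L[ℝ] Bundle.Trivial M ℝ x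

/-- The total space of the dual line bundle `L^*`. -/
abbrev DualTotal : Type := TotalSpace (ℝ →L[ℝ] ℝ) (DualFiber L)

/-- The local frame of `L` given by the preferred trivialization at `x₀`. -/
def lineFrame (x₀ x : M) : L x := (trivializationAt ℝ L x₀).symm x 1

/-- The coordinate of a covector with respect to a local frame of `L`. -/
def dualCoord (x₀ : M) (q : DualTotal L) : ℝ := q.2 (lineFrame L x₀ q.1)

variable {L}

theorem eq_smul_lineFrame {x₀ x : M} (hx : x ∈ (trivializationAt ℝ L x₀).baseSet) (v : L x) :
    v = (trivializationAt ℝ L x₀ ⟨x, v⟩).2 • lineFrame L x₀ x := by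
  have h := (trivializationAt ℝ L x₀).symm_apply_apply_mk hx v
  conv_lhs => rw [← h]
  rw [lineFrame, ← Trivialization.symmL_apply (R := ℝ) _ hx,
    ← Trivialization.symmL_apply (R := ℝ) _ hx, ← map_smul, smul_eq_mul, mul_one]

theorem triv_lineFrame {x₀ x : M} (hx : x ∈ (trivializationAt ℝ L x₀).baseSet) :
    (trivializationAt ℝ L x₀ ⟨x, lineFrame L x₀ x⟩).2 = 1 := by
  rw [lineFrame, Trivialization.apply_mk_symm _ hx]

theorem triv_smul {x₀ x : M} (hx : x ∈ (trivializationAt ℝ L x₀).baseSet) (c : ℝ) (v : L x) :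
    (trivializationAt ℝ L x₀ ⟨x, c • v⟩).2 = c * (trivializationAt ℝ L x₀ ⟨x, v⟩).2 := by
  have := ((trivializationAt ℝ L x₀).linear ℝ hx).map_smul c v
  simpa using this

theorem lineFrame_ne_zero {x₀ x : M} (hx : x ∈ (trivializationAt ℝ L x₀).baseSet) :
    lineFrame L x₀ x ≠ 0 := by
  intro h
  have h1 := triv_lineFrame hx
  have h2 := triv_smul hx 0 (lineFrame L x₀ x)
  rw [zero_smul, ← h, h1] at h2
  norm_num at h2

theorem dualCoord_ne_zero {x₀ : M} {q : DualTotal L}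
    (hx : q.1 ∈ (trivializationAt ℝ L x₀).baseSet) (hq : q.2 ≠ 0) : dualCoord L x₀ q ≠ 0 := by
  intro h
  apply hq
  ext v
  rw [eq_smul_lineFrame hx v, map_smul]
  change _ • dualCoord L x₀ q = 0
  rw [h, smul_zero]

theorem dual_ext {x₀ x : M} (hx : x ∈ (trivializationAt ℝ L x₀).baseSet) {ε ε' : DualFiber L x}
    (h : ε (lineFrame L x₀ x) = ε' (lineFrame L x₀ x)) : ε = ε' := by
  ext v
  rw [eq_smul_lineFrame hx v, map_smul, map_smul, h]

theorem dualTriv_snd (x₀ : M) (q : DualTotal L)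
    (hx : q.1 ∈ (trivializationAt ℝ L x₀).baseSet) :
    (trivializationAt (ℝ →L[ℝ] ℝ) (DualFiber L) x₀ q).2 =
      (ContinuousLinearMap.toSpanSingleton ℝ (dualCoord L x₀ q)) := by
  rw [hom_trivializationAt_apply]
  ext
  simp [ContinuousLinearMap.inCoordinates, dualCoord, lineFrame, Trivialization.symmL_apply _ hx]

variable {E' H' N : Type} [NormedAddCommGroup E'] [NormedSpace ℝ E'] [TopologicalSpace H']
  {I' : ModelWithCorners ℝ E' H'} [TopologicalSpace N] [ChartedSpace H' N]

theorem contMDiffAt_dual_iff {f : N → DualTotal L} {n₀ : N} {x₀ : M}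
    [ContMDiffVectorBundle ∞ ℝ L I] [IsManifold I ∞ M]
    (hx₀ : (f n₀).1 ∈ (trivializationAt ℝ L x₀).baseSet) :
    ContMDiffAt I' (I.prod 𝓘(ℝ, ℝ →L[ℝ] ℝ)) ∞ f n₀ ↔
      ContMDiffAt I' I ∞ (fun n ↦ (f n).1) n₀ ∧
        ContMDiffAt I' 𝓘(ℝ, ℝ) ∞ (fun n ↦ dualCoord L x₀ (f n)) n₀ := by
  have hx₀' : f n₀ ∈ (trivializationAt (ℝ →L[ℝ] ℝ) (DualFiber L) x₀).source := by
    rw [Trivialization.mem_source, hom_trivializationAt_baseSet]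
    exact ⟨hx₀, Set.mem_univ _⟩
  have key : ∀ h : ContMDiffAt I' I ∞ (fun n ↦ (f n).1) n₀,
      (∀ᶠ n in 𝓝 n₀, (trivializationAt (ℝ →L[ℝ] ℝ) (DualFiber L) x₀ (f n)).2 =
        (ContinuousLinearMap.toSpanSingleton ℝ (dualCoord L x₀ (f n)))) := by
    intro h
    filter_upwards [h.continuousAt.preimage_mem_nhds
      ((trivializationAt ℝ L x₀).open_baseSet.mem_nhds hx₀)] with n hn
    exact dualTriv_snd x₀ (f n) hn
  constructor
  · intro h
    have h1 : ContMDiffAt I' I ∞ (fun n ↦ (f n).1) n₀ := (contMDiffAt_totalSpace.1 h).1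
    refine ⟨h1, ?_⟩
    have h2 := ((Trivialization.contMDiffAt_iff (IB := I) hx₀').1 h).2
    have h3 := ContMDiffAt.clm_apply h2 (contMDiffAt_const (c := (1 : ℝ)))
    refine h3.congr_of_eventuallyEq ?_
    filter_upwards [key h1] with n hn
    rw [hn]; simp
  · rintro ⟨h1, h2⟩
    refine (Trivialization.contMDiffAt_iff (IB := I) hx₀').2 ⟨h1, ?_⟩
    have h3 : ContMDiffAt I' 𝓘(ℝ, ℝ →L[ℝ] ℝ) ∞
        (fun n ↦ (ContinuousLinearMap.toSpanSingletonCLE (𝕜 := ℝ) (E := ℝ) : ℝ →L[ℝ] (ℝ →L[ℝ] ℝ))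
          (dualCoord L x₀ (f n))) n₀ :=
      (ContinuousLinearMap.contMDiff _).contMDiffAt.comp n₀ h2
    refine h3.congr_of_eventuallyEq ?_
    filter_upwards [key h1] with n hn
    rw [hn]; rfl

theorem contMDiffAt_line_iff {f : N → TotalSpace ℝ L} {n₀ : N} {x₀ : M}
    [ContMDiffVectorBundle ∞ ℝ L I] [IsManifold I ∞ M]
    (hx₀ : (f n₀).1 ∈ (trivializationAt ℝ L x₀).baseSet) :
    ContMDiffAt I' (I.prod 𝓘(ℝ, ℝ)) ∞ f n₀ ↔
      ContMDiffAt I' I ∞ (fun n ↦ (f n).1) n₀ ∧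
        ContMDiffAt I' 𝓘(ℝ, ℝ) ∞ (fun n ↦ (trivializationAt ℝ L x₀ (f n)).2) n₀ :=
  Trivialization.contMDiffAt_iff (IB := I) ((Trivialization.mem_source _).2 hx₀)

variable (L) in
theorem contMDiffAt_lineFrame [ContMDiffVectorBundle ∞ ℝ L I] [IsManifold I ∞ M]
    {x₀ x : M} (hx : x ∈ (trivializationAt ℝ L x₀).baseSet) :
    ContMDiffAt I (I.prod 𝓘(ℝ, ℝ)) ∞ (fun y ↦ (⟨y, lineFrame L x₀ y⟩ : TotalSpace ℝ L)) x := by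
  rw [contMDiffAt_line_iff (x₀ := x₀) hx]
  refine ⟨contMDiffAt_id, (contMDiffAt_const (c := (1 : ℝ))).congr_of_eventuallyEq ?_⟩
  filter_upwards [(trivializationAt ℝ L x₀).open_baseSet.mem_nhds hx] with y hy
  exact triv_lineFrame hy

end LineBundleFacts

section Topology

variable {M Z F : Type} [TopologicalSpace M] [TopologicalSpace Z] [TopologicalSpace F]
  {p : Z → M}

theorem t2Space_of_trivializations [T2Space M] [T2Space F] (hp : Continuous p)
    (h : ∀ x, ∃ e : Trivialization F p, x ∈ e.baseSet) : T2Space Z := by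
  refine ⟨fun a b hab ↦ ?_⟩
  by_cases hpab : p a = p b
  · obtain ⟨e, he⟩ := h (p a)
    have ha : a ∈ e.source := e.mem_source.2 he
    have hb : b ∈ e.source := e.mem_source.2 (hpab ▸ he)
    have hne : e a ≠ e b := fun h' ↦ hab (e.injOn ha hb h')
    obtain ⟨u, v, hu, hv, hau, hbv, huv⟩ := t2_separation hne
    refine ⟨e.source ∩ e ⁻¹' u, e.source ∩ e ⁻¹' v,
      e.toOpenPartialHomeomorph.isOpen_inter_preimage hu,
      e.toOpenPartialHomeomorph.isOpen_inter_preimage hv, ⟨ha, hau⟩, ⟨hb, hbv⟩, ?_⟩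
    exact ((huv.preimage e).mono Set.inter_subset_right Set.inter_subset_right)
  · obtain ⟨u, v, hu, hv, hau, hbv, huv⟩ := t2_separation hpab
    exact ⟨p ⁻¹' u, p ⁻¹' v, hu.preimage hp, hv.preimage hp, hau, hbv, huv.preimage p⟩

theorem secondCountable_of_trivializations [SecondCountableTopology M] [SecondCountableTopology F]
    (h : ∀ x, ∃ e : Trivialization F p, x ∈ e.baseSet) : SecondCountableTopology Z := by
  choose e he using h
  obtain ⟨s, hs, hcov⟩ := TopologicalSpace.countable_cover_nhds
    (f := fun x ↦ (e x).baseSet) (fun x ↦ (e x).open_baseSet.mem_nhds (he x))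
  have := hs.to_subtype
  have hU : ∀ i : s, SecondCountableTopology (e i).source := fun i ↦
    ((e (i : M)).toOpenPartialHomeomorph.toHomeomorphSourceTarget).secondCountableTopology
  refine TopologicalSpace.secondCountableTopology_of_countable_cover
    (U := fun i : s ↦ (e i).source) (fun i ↦ (e (i : M)).open_source) ?_
  refine Set.eq_univ_of_forall fun z ↦ ?_
  have hz : p z ∈ ⋃ x ∈ s, (e x).baseSet := hcov ▸ Set.mem_univ _
  simp only [Set.mem_iUnion] at hz ⊢
  obtain ⟨x, hx, hz⟩ := hz
  exact ⟨⟨x, hx⟩, (e x).mem_source.2 hz⟩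

end Topology

/-- A smooth manifold: finite-dimensional, without boundary, Hausdorff and second countable. -/
structure SmoothManifold where
  carrier : Type
  E : Type
  H : Type
  [normedAddCommGroup : NormedAddCommGroup E]
  [normedSpace : NormedSpace ℝ E]
  [finiteDimensional : FiniteDimensional ℝ E]
  [topologicalSpaceModel : TopologicalSpace H]
  I : ModelWithCorners ℝ E H
  [boundaryless : I.Boundaryless]
  [topologicalSpace : TopologicalSpace carrier]
  [chartedSpace : ChartedSpace H carrier]
  [isManifold : IsManifold I ∞ carrier]
  [t2Space : T2Space carrier]
  [secondCountable : SecondCountableTopology carrier]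

namespace SmoothManifold

instance : CoeSort SmoothManifold Type := ⟨carrier⟩

attribute [instance] normedAddCommGroup normedSpace finiteDimensional topologicalSpaceModel
  boundaryless topologicalSpace chartedSpace isManifold t2Space secondCountable

/-- Smooth maps between manifolds. -/
abbrev Map (M N : SmoothManifold) : Type := C^∞⟮M.I, M; N.I, N⟯

/-- The algebra `C^∞(M)`. -/
abbrev Fun (M : SmoothManifold) : Type := C^∞⟮M.I, M; 𝓘(ℝ, ℝ), ℝ⟯

/-- Smooth vector fields on `M`. -/
abbrev VectorField (M : SmoothManifold) : Type := Cₛ^∞⟮M.I; M.E, fun x : M ↦ TangentSpace M.I x⟯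

/-- The derivative `X(f)` of a function along a vector field, at a point. -/
def VectorField.deriv {M : SmoothManifold} (X : M.VectorField) (f : M.Fun) (x : M) : ℝ :=
  mfderiv M.I 𝓘(ℝ, ℝ) f x (X x)

/-- The pull-back `Φ^* f`. -/
def pullback {M N : SmoothManifold} (Φ : M.Map N) (f : N.Fun) : M.Fun := f.comp Φ

end SmoothManifold

/-- A smooth real line bundle over a smooth manifold. -/
structure LineBundle where
  base : SmoothManifold
  fiber : base → Type
  [addCommGroup : ∀ x, AddCommGroup (fiber x)]
  [module : ∀ x, Module ℝ (fiber x)]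
  [topologicalSpaceFiber : ∀ x, TopologicalSpace (fiber x)]
  [topologicalSpace : TopologicalSpace (TotalSpace ℝ fiber)]
  [fiberBundle : FiberBundle ℝ fiber]
  [vectorBundle : VectorBundle ℝ ℝ fiber]
  [contMDiffVectorBundle : ContMDiffVectorBundle ∞ ℝ fiber base.I]

namespace LineBundle

attribute [instance] addCommGroup module topologicalSpaceFiber topologicalSpace fiberBundle
  vectorBundle contMDiffVectorBundle

/-- The smooth sections `Γ(L)`. -/
abbrev Sections (L : LineBundle) : Type := Cₛ^∞⟮L.base.I; ℝ, L.fiber⟯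

/-- The product `f λ` of a function and a section. -/
def smulSection {L : LineBundle} (f : L.base.Fun) (s : L.Sections) : L.Sections :=
  ⟨fun x ↦ f x • s x, f.contMDiff.smul_section s.contMDiff⟩

/-- A derivation of `L`: an `ℝ`-linear operator `D` on sections with
`D (f e) = X(f) e + f D e` for some vector field `X`. -/
def IsDerivation {L : LineBundle} (D : L.Sections →ₗ[ℝ] L.Sections) : Prop :=
  ∃ X : L.base.VectorField, ∀ (f : L.base.Fun) (e : L.Sections) (x : L.base),
    D (smulSection f e) x = X.deriv f x • e x + f x • D e x

/-- A fibre-wise invertible line bundle map `L₁ → L₂`. -/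
@[ext]
structure Hom (L₁ L₂ : LineBundle) where
  base : L₁.base.Map L₂.base
  fiber : ∀ x, L₁.fiber x ≃L[ℝ] L₂.fiber (base x)
  contMDiff_total : ContMDiff (L₁.base.I.prod 𝓘(ℝ, ℝ)) (L₂.base.I.prod 𝓘(ℝ, ℝ)) ∞
    (fun v : TotalSpace ℝ L₁.fiber ↦ (⟨base v.1, fiber v.1 v.2⟩ : TotalSpace ℝ L₂.fiber))

namespace Hom

variable {L₁ L₂ L₃ : LineBundle}

def id (L : LineBundle) : Hom L L where
  base := ContMDiffMap.id
  fiber x := ContinuousLinearEquiv.refl ℝ (L.fiber x)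
  contMDiff_total := contMDiff_id

def comp (G : Hom L₂ L₃) (F : Hom L₁ L₂) : Hom L₁ L₃ where
  base := G.base.comp F.base
  fiber x := (F.fiber x).trans (G.fiber (F.base x))
  contMDiff_total := G.contMDiff_total.comp F.contMDiff_total

/-- The local coefficient of a line bundle map with respect to local frames. -/
def coeff (F : Hom L₁ L₂) (x₀ x : L₁.base) : ℝ :=
  (trivializationAt ℝ L₂.fiber (F.base x₀)
    ⟨F.base x, F.fiber x (lineFrame L₁.fiber x₀ x)⟩).2

theorem contMDiffAt_coeff (F : Hom L₁ L₂) (x₀ : L₁.base) :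
    ContMDiffAt L₁.base.I 𝓘(ℝ, ℝ) ∞ (F.coeff x₀) x₀ := by
  have h := F.contMDiff_total.contMDiffAt.comp x₀
    (contMDiffAt_lineFrame L₁.fiber (I := L₁.base.I)
      (mem_baseSet_trivializationAt ℝ L₁.fiber x₀))
  exact ((contMDiffAt_line_iff (x₀ := F.base x₀)
    (mem_baseSet_trivializationAt ℝ L₂.fiber (F.base x₀))).1 h).2

theorem eventually_mem (F : Hom L₁ L₂) (x₀ : L₁.base) :
    ∀ᶠ x in 𝓝 x₀, x ∈ (trivializationAt ℝ L₁.fiber x₀).baseSet ∧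
      F.base x ∈ (trivializationAt ℝ L₂.fiber (F.base x₀)).baseSet := by
  refine Filter.Eventually.and ((trivializationAt ℝ L₁.fiber x₀).open_baseSet.mem_nhds
    (mem_baseSet_trivializationAt ℝ L₁.fiber x₀)) ?_
  exact F.base.contMDiff.continuous.continuousAt.preimage_mem_nhds
    ((trivializationAt ℝ L₂.fiber (F.base x₀)).open_baseSet.mem_nhds
    (mem_baseSet_trivializationAt ℝ L₂.fiber (F.base x₀)))

theorem fiber_lineFrame (F : Hom L₁ L₂) {x₀ x : L₁.base}
    (h : F.base x ∈ (trivializationAt ℝ L₂.fiber (F.base x₀)).baseSet) :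
    F.fiber x (lineFrame L₁.fiber x₀ x) =
      F.coeff x₀ x • lineFrame L₂.fiber (F.base x₀) (F.base x) :=
  eq_smul_lineFrame h _

theorem coeff_ne_zero (F : Hom L₁ L₂) {x₀ x : L₁.base}
    (h₁ : x ∈ (trivializationAt ℝ L₁.fiber x₀).baseSet)
    (h₂ : F.base x ∈ (trivializationAt ℝ L₂.fiber (F.base x₀)).baseSet) :
    F.coeff x₀ x ≠ 0 := by
  intro h0
  have h := F.fiber_lineFrame h₂
  rw [h0, zero_smul] at h
  exact lineFrame_ne_zero h₁ ((F.fiber x).map_eq_zero_iff.1 h)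

theorem fiber_symm_lineFrame (F : Hom L₁ L₂) {x₀ x : L₁.base}
    (h₁ : x ∈ (trivializationAt ℝ L₁.fiber x₀).baseSet)
    (h₂ : F.base x ∈ (trivializationAt ℝ L₂.fiber (F.base x₀)).baseSet) :
    (F.fiber x).symm (lineFrame L₂.fiber (F.base x₀) (F.base x)) =
      (F.coeff x₀ x)⁻¹ • lineFrame L₁.fiber x₀ x := by
  rw [ContinuousLinearEquiv.symm_apply_eq, map_smul, F.fiber_lineFrame h₂, smul_smul,
    inv_mul_cancel₀ (F.coeff_ne_zero h₁ h₂), one_smul]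

/-- The pull-back `F^* λ` of a section, `(F^* λ)_x = F_x⁻¹ (λ_{φ(x)})`. -/
def pullback (F : Hom L₁ L₂) (s : L₂.Sections) : L₁.Sections where
  toFun x := (F.fiber x).symm (s (F.base x))
  contMDiff_toFun := by
    intro x₀
    rw [contMDiffAt_line_iff (x₀ := x₀) (mem_baseSet_trivializationAt ℝ L₁.fiber x₀)]
    refine ⟨contMDiffAt_id, ?_⟩
    have h1 : ContMDiffAt L₁.base.I 𝓘(ℝ, ℝ) ∞
        (fun x ↦ (trivializationAt ℝ L₂.fiber (F.base x₀) ⟨F.base x, s (F.base x)⟩).2) x₀ :=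
      ((contMDiffAt_line_iff (x₀ := F.base x₀)
        (f := fun x ↦ (⟨F.base x, s (F.base x)⟩ : TotalSpace ℝ L₂.fiber))
        (mem_baseSet_trivializationAt ℝ L₂.fiber (F.base x₀))).1
        (s.contMDiff.comp F.base.contMDiff).contMDiffAt).2
    have h2 := (F.contMDiffAt_coeff x₀).inv₀
      (F.coeff_ne_zero (mem_baseSet_trivializationAt ℝ L₁.fiber x₀)
        (mem_baseSet_trivializationAt ℝ L₂.fiber (F.base x₀)))
    refine (h1.mul h2).congr_of_eventuallyEq ?_
    filter_upwards [F.eventually_mem x₀] with x hx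
    have h3 := eq_smul_lineFrame hx.2 (s (F.base x))
    change (trivializationAt ℝ L₁.fiber x₀ ⟨x, (F.fiber x).symm (s (F.base x))⟩).2 = _
    conv_lhs => rw [h3, map_smul, F.fiber_symm_lineFrame hx.1 hx.2]
    rw [triv_smul hx.1, triv_smul hx.1, triv_lineFrame hx.1, mul_one]
    rfl

end Hom
end LineBundle

/-- A homogeneous manifold: a principal `ℝ^*`-bundle `total → base`. -/
structure HomogeneousManifold where
  base : SmoothManifold
  total : SmoothManifold
  proj : total → base
  [action : MulAction ℝˣ total]
  [contMDiffSMul : ContMDiffSMul 𝓘(ℝ, ℝ) total.I ∞ ℝˣ total]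
  contMDiff_proj : ContMDiff total.I base.I ∞ proj
  proj_smul : ∀ (t : ℝˣ) (p : total), proj (t • p) = proj p
  /-- Around each point of the base there is a smooth equivariant local trivialization
  `proj⁻¹ U ≅ U × ℝ^*`. -/
  exists_trivialization : ∀ x : base, ∃ e : Trivialization ℝˣ proj, x ∈ e.baseSet ∧
    ContMDiffOn total.I (base.I.prod 𝓘(ℝ, ℝ)) ∞ e e.source ∧
    ContMDiffOn (base.I.prod 𝓘(ℝ, ℝ)) total.I ∞ e.toOpenPartialHomeomorph.symm e.target ∧
    ∀ (t : ℝˣ), ∀ p ∈ e.source, e (t • p) = (proj p, t * (e p).2)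

namespace HomogeneousManifold

attribute [instance] action contMDiffSMul

/-- The action of `t ∈ ℝ^*` as a smooth map `h_t`. -/
def h (P : HomogeneousManifold) (t : ℝˣ) : P.total.Map P.total :=
  ⟨fun p ↦ t • p, (contMDiff_smul (I := 𝓘(ℝ, ℝ)) (I' := P.total.I) (n := ∞)).comp
    (contMDiff_const.prodMk contMDiff_id)⟩

/-- `ℝ^*`-equivariant smooth maps. -/
@[ext]
structure Hom (P Q : HomogeneousManifold) where
  toMap : P.total.Map Q.total
  map_smul : ∀ (t : ℝˣ) (p : P.total), toMap (t • p) = t • toMap p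

namespace Hom

variable {P Q R : HomogeneousManifold}

def id (P : HomogeneousManifold) : Hom P P where
  toMap := ContMDiffMap.id
  map_smul _ _ := rfl

def comp (Ψ : Hom Q R) (Φ : Hom P Q) : Hom P R where
  toMap := Ψ.toMap.comp Φ.toMap
  map_smul t p := by
    change Ψ.toMap (Φ.toMap (t • p)) = t • Ψ.toMap (Φ.toMap p)
    rw [Φ.map_smul, Ψ.map_smul]

end Hom
end HomogeneousManifold

namespace LineBundle

variable (L : LineBundle)

/-- The complement of the zero section in the total space of `L^*`. -/
def slit : TopologicalSpace.Opens (DualTotal L.fiber) where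
  carrier := {q | q.2 ≠ 0}
  is_open' := by
    have hc : ∀ x₀ : L.base, IsOpen (TotalSpace.proj ⁻¹' (trivializationAt ℝ L.fiber x₀).baseSet ∩
        (dualCoord L.fiber x₀) ⁻¹' {0}ᶜ : Set (DualTotal L.fiber)) := fun x₀ ↦ by
      refine ContinuousOn.isOpen_inter_preimage (fun q hq ↦ ?_)
        ((trivializationAt ℝ L.fiber x₀).open_baseSet.preimage
          (FiberBundle.continuous_proj (ℝ →L[ℝ] ℝ) (DualFiber L.fiber))) isOpen_compl_singleton
      exact ((contMDiffAt_dual_iff (I := L.base.I) (I' := L.base.I.prod 𝓘(ℝ, ℝ →L[ℝ] ℝ))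
        (f := fun q : DualTotal L.fiber ↦ q) (x₀ := x₀) hq).1
          contMDiffAt_id).2.continuousAt.continuousWithinAt
    convert isOpen_iUnion hc using 1
    ext q
    simp only [Set.mem_ofPred_eq, Set.mem_iUnion, Set.mem_inter_iff, Set.mem_preimage,
      Set.mem_compl_iff, Set.mem_singleton_iff]
    refine ⟨fun hq ↦ ⟨q.1, mem_baseSet_trivializationAt ℝ L.fiber q.1, dualCoord_ne_zero
      (mem_baseSet_trivializationAt ℝ L.fiber q.1) hq⟩, ?_⟩
    rintro ⟨x₀, -, hq⟩ h0
    exact hq (by rw [dualCoord, h0]; rfl)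

variable {L}

/-- A nonzero covector, as a point of the slit dual. -/
def slitMk (x : L.base) (ε : DualFiber L.fiber x) (hε : ε ≠ 0) : L.slit := ⟨⟨x, ε⟩, hε⟩

theorem contMDiffAt_slit_iff {E' H' N : Type} [NormedAddCommGroup E'] [NormedSpace ℝ E']
    [TopologicalSpace H'] {I' : ModelWithCorners ℝ E' H'} [TopologicalSpace N]
    [ChartedSpace H' N] {f : N → L.slit} {n₀ : N} {x₀ : L.base}
    (hx₀ : (f n₀).1.1 ∈ (trivializationAt ℝ L.fiber x₀).baseSet) :
    ContMDiffAt I' (L.base.I.prod 𝓘(ℝ, ℝ →L[ℝ] ℝ)) ∞ f n₀ ↔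
      ContMDiffAt I' L.base.I ∞ (fun n ↦ (f n).1.1) n₀ ∧
        ContMDiffAt I' 𝓘(ℝ, ℝ) ∞ (fun n ↦ dualCoord L.fiber x₀ (f n).1) n₀ := by
  rw [← contMDiffAt_dual_iff (f := fun n ↦ (f n).1) hx₀]
  exact (ContMDiffAt.subtypeVal_comp_iff L.slit f n₀).symm

theorem contMDiff_slit_proj :
    ContMDiff (L.base.I.prod 𝓘(ℝ, ℝ →L[ℝ] ℝ)) L.base.I ∞ (fun q : L.slit ↦ q.1.1) :=
  (Bundle.contMDiff_proj (DualFiber L.fiber)).comp contMDiff_subtype_val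

theorem contMDiffAt_slit_coord {x₀ : L.base} {q : L.slit}
    (hx₀ : q.1.1 ∈ (trivializationAt ℝ L.fiber x₀).baseSet) :
    ContMDiffAt (L.base.I.prod 𝓘(ℝ, ℝ →L[ℝ] ℝ)) 𝓘(ℝ, ℝ) ∞
      (fun q : L.slit ↦ dualCoord L.fiber x₀ q.1) q :=
  ((contMDiffAt_slit_iff (f := fun q : L.slit ↦ q) hx₀).1 contMDiffAt_id).2

/-- Scalar multiplication of `ℝ^*` on `L^* ∖ 0`. -/
instance slitAction : MulAction ℝˣ L.slit where
  smul t q := ⟨⟨q.1.1, (t : ℝ) • q.1.2⟩, smul_ne_zero t.ne_zero q.2⟩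
  one_smul q := Subtype.ext (by
    change (⟨q.1.1, ((1 : ℝˣ) : ℝ) • q.1.2⟩ : DualTotal L.fiber) = q.1
    rw [Units.val_one, one_smul])
  mul_smul s t q := Subtype.ext (by
    change (⟨q.1.1, ((s * t : ℝˣ) : ℝ) • q.1.2⟩ : DualTotal L.fiber) =
      ⟨q.1.1, (s : ℝ) • (t : ℝ) • q.1.2⟩
    rw [Units.val_mul, mul_smul])

theorem dualCoord_smul (x₀ : L.base) (t : ℝˣ) (q : L.slit) :
    dualCoord L.fiber x₀ (t • q).1 = (t : ℝ) * dualCoord L.fiber x₀ q.1 := rfl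

theorem contMDiff_slit_smul : ContMDiff (𝓘(ℝ, ℝ).prod (L.base.I.prod 𝓘(ℝ, ℝ →L[ℝ] ℝ)))
    (L.base.I.prod 𝓘(ℝ, ℝ →L[ℝ] ℝ)) ∞ (fun a : ℝˣ × L.slit ↦ a.1 • a.2) := by
  intro a
  have ha : a.2.1.1 ∈ (trivializationAt ℝ L.fiber a.2.1.1).baseSet :=
    mem_baseSet_trivializationAt ℝ L.fiber _
  refine (contMDiffAt_slit_iff (f := fun a : ℝˣ × L.slit ↦ a.1 • a.2) (x₀ := a.2.1.1) ha).2 ?_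
  refine ⟨(contMDiff_slit_proj.comp contMDiff_snd).contMDiffAt, ?_⟩
  have h1 : ContMDiffAt (𝓘(ℝ, ℝ).prod (L.base.I.prod 𝓘(ℝ, ℝ →L[ℝ] ℝ))) 𝓘(ℝ, ℝ) ∞
      (fun a : ℝˣ × L.slit ↦ (a.1 : ℝ)) a :=
    (Units.contMDiff_val.comp contMDiff_fst).contMDiffAt
  exact h1.mul ((contMDiffAt_slit_coord ha).comp a contMDiffAt_snd)

instance slitContMDiffSMul : ContMDiffSMul 𝓘(ℝ, ℝ) (L.base.I.prod 𝓘(ℝ, ℝ →L[ℝ] ℝ)) ∞ ℝˣ L.slit :=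
  ⟨contMDiff_slit_smul⟩

open Classical in
/-- The nonzero part of the trivialization of `L^*` at `x₀`. -/
def slitFiberCoord (x₀ : L.base) (q : L.slit) : ℝˣ :=
  if h : dualCoord L.fiber x₀ q.1 = 0 then 1 else Units.mk0 _ h

theorem slitFiberCoord_val {x₀ : L.base} {q : L.slit}
    (hq : q.1.1 ∈ (trivializationAt ℝ L.fiber x₀).baseSet) :
    (slitFiberCoord x₀ q : ℝ) = dualCoord L.fiber x₀ q.1 := by
  rw [slitFiberCoord, dif_neg (dualCoord_ne_zero hq q.2)]
  rfl

theorem contMDiffAt_units {E' H' N : Type} [NormedAddCommGroup E'] [NormedSpace ℝ E']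
    [TopologicalSpace H'] {I' : ModelWithCorners ℝ E' H'} [TopologicalSpace N]
    [ChartedSpace H' N] {f : N → ℝˣ} {n₀ : N}
    (h : ContMDiffAt I' 𝓘(ℝ, ℝ) ∞ (fun n ↦ (f n : ℝ)) n₀) : ContMDiffAt I' 𝓘(ℝ, ℝ) ∞ f n₀ := by
  have h1 := contMDiffOn_isOpenEmbedding_symm (I := 𝓘(ℝ, ℝ)) (n := ∞)
    (Units.isOpenEmbedding_val (R := ℝ))
  have h2 := (h1.contMDiffAt ((Units.isOpenEmbedding_val (R := ℝ)).isOpen_range.mem_nhds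
    ⟨f n₀, rfl⟩)).comp n₀ h
  refine h2.congr_of_eventuallyEq (Filter.Eventually.of_forall fun n ↦ ?_)
  exact ((Units.isOpenEmbedding_val (R := ℝ)).toOpenPartialHomeomorph_left_inv).symm

/-- The covector dual to the frame of `L` at `x` (given by the trivialization at `x₀` if `x` lies
in its domain). -/
def slitFrame (x₀ x : L.base) : DualFiber L.fiber x :=
  open Classical in
  if x ∈ (trivializationAt ℝ L.fiber x₀).baseSet then
    (trivializationAt ℝ L.fiber x₀).continuousLinearMapAt ℝ x
  else (trivializationAt ℝ L.fiber x).continuousLinearMapAt ℝ x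

theorem clmAt_lineFrame {x₀ x : L.base} (h : x ∈ (trivializationAt ℝ L.fiber x₀).baseSet) :
    (trivializationAt ℝ L.fiber x₀).continuousLinearMapAt ℝ x (lineFrame L.fiber x₀ x) = 1 := by
  rw [lineFrame, ← Trivialization.symmL_apply (R := ℝ) _ h,
    Trivialization.continuousLinearMapAt_symmL _ h]

theorem slitFrame_lineFrame {x₀ x : L.base}
    (h : x ∈ (trivializationAt ℝ L.fiber x₀).baseSet) :
    slitFrame x₀ x (lineFrame L.fiber x₀ x) = (1 : ℝ) := by
  rw [slitFrame, if_pos h]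
  exact clmAt_lineFrame h

theorem slitFrame_ne_zero (x₀ x : L.base) : slitFrame x₀ x ≠ 0 := by
  intro h
  have hx := mem_baseSet_trivializationAt ℝ L.fiber x
  by_cases hm : x ∈ (trivializationAt ℝ L.fiber x₀).baseSet
  · have h1 := slitFrame_lineFrame hm
    rw [h] at h1
    exact zero_ne_one (α := ℝ) h1
  · have h1 := clmAt_lineFrame hx
    rw [slitFrame, if_neg hm] at h
    have h2 := DFunLike.congr_fun h (lineFrame L.fiber x x)
    exact zero_ne_one (α := ℝ) (h2.symm.trans h1)

/-- The inverse `(x, t) ↦ t ε_x` of the local trivialization of `L^* ∖ 0`. -/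
def slitSymm (x₀ : L.base) (a : L.base × ℝˣ) : L.slit :=
  a.2 • slitMk a.1 (slitFrame x₀ a.1) (slitFrame_ne_zero x₀ a.1)

theorem dualCoord_slitSymm {x₀ : L.base} {a : L.base × ℝˣ}
    (h : a.1 ∈ (trivializationAt ℝ L.fiber x₀).baseSet) :
    dualCoord L.fiber x₀ (slitSymm x₀ a).1 = a.2 := by
  rw [slitSymm, dualCoord_smul]
  change (a.2 : ℝ) * slitFrame x₀ a.1 (lineFrame L.fiber x₀ a.1) = a.2
  rw [slitFrame_lineFrame h, mul_one]

theorem contMDiffAt_slitCoord {x₀ : L.base} {q : L.slit}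
    (hq : q.1.1 ∈ (trivializationAt ℝ L.fiber x₀).baseSet) :
    ContMDiffAt (L.base.I.prod 𝓘(ℝ, ℝ →L[ℝ] ℝ)) (L.base.I.prod 𝓘(ℝ, ℝ)) ∞
      (fun q : L.slit ↦ (q.1.1, slitFiberCoord x₀ q)) q := by
  refine contMDiff_slit_proj.contMDiffAt.prodMk (contMDiffAt_units ?_)
  refine (contMDiffAt_slit_coord hq).congr_of_eventuallyEq ?_
  filter_upwards [contMDiff_slit_proj.continuous.continuousAt.preimage_mem_nhds
    ((trivializationAt ℝ L.fiber x₀).open_baseSet.mem_nhds hq)] with p hp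
  exact slitFiberCoord_val hp

theorem contMDiffAt_slitSymm {x₀ : L.base} {a : L.base × ℝˣ}
    (h : a.1 ∈ (trivializationAt ℝ L.fiber x₀).baseSet) :
    ContMDiffAt (L.base.I.prod 𝓘(ℝ, ℝ)) (L.base.I.prod 𝓘(ℝ, ℝ →L[ℝ] ℝ)) ∞
      (slitSymm x₀) a := by
  rw [contMDiffAt_slit_iff (x₀ := x₀) h]
  refine ⟨contMDiffAt_fst, ?_⟩
  have h1 : ContMDiffAt (L.base.I.prod 𝓘(ℝ, ℝ)) 𝓘(ℝ, ℝ) ∞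
      (fun a : L.base × ℝˣ ↦ (a.2 : ℝ)) a :=
    (Units.contMDiff_val.comp contMDiff_snd).contMDiffAt
  refine h1.congr_of_eventuallyEq ?_
  filter_upwards [continuous_fst.continuousAt.preimage_mem_nhds
    ((trivializationAt ℝ L.fiber x₀).open_baseSet.mem_nhds h)] with b hb
  exact dualCoord_slitSymm hb

/-- The local trivialization of `L^* ∖ 0` determined by the one of `L` at `x₀`. -/
def slitTrivialization (x₀ : L.base) : Trivialization ℝˣ (fun q : L.slit ↦ q.1.1) where
  toFun q := (q.1.1, slitFiberCoord x₀ q)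
  invFun := slitSymm x₀
  source := (fun q : L.slit ↦ q.1.1) ⁻¹' (trivializationAt ℝ L.fiber x₀).baseSet
  target := (trivializationAt ℝ L.fiber x₀).baseSet ×ˢ Set.univ
  map_source' q hq := ⟨hq, Set.mem_univ _⟩
  map_target' a ha := ha.1
  left_inv' q hq := by
    refine Subtype.ext ?_
    change (⟨q.1.1, _⟩ : DualTotal L.fiber) = ⟨q.1.1, q.1.2⟩
    congr 1
    refine dual_ext (L := L.fiber) (x₀ := x₀) hq ?_
    exact (dualCoord_slitSymm (a := (q.1.1, slitFiberCoord x₀ q)) hq).trans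
      (slitFiberCoord_val hq)
  right_inv' a ha := by
    refine Prod.ext rfl (Units.ext ?_)
    change (slitFiberCoord x₀ (slitSymm x₀ a) : ℝ) = a.2
    have ha' : a.1 ∈ (trivializationAt ℝ L.fiber x₀).baseSet := ha.1
    rw [slitFiberCoord_val (q := slitSymm x₀ a) ha', dualCoord_slitSymm ha']
  open_source := (trivializationAt ℝ L.fiber x₀).open_baseSet.preimage
    contMDiff_slit_proj.continuous
  open_target := (trivializationAt ℝ L.fiber x₀).open_baseSet.prod isOpen_univ
  continuousOn_toFun _ hq := (contMDiffAt_slitCoord hq).continuousAt.continuousWithinAt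
  continuousOn_invFun _ ha := (contMDiffAt_slitSymm ha.1).continuousAt.continuousWithinAt
  baseSet := (trivializationAt ℝ L.fiber x₀).baseSet
  open_baseSet := (trivializationAt ℝ L.fiber x₀).open_baseSet
  source_eq := rfl
  target_eq := rfl
  proj_toFun _ _ := rfl

theorem slitFiberCoord_smul (x : L.base) (t : ℝˣ) (q : L.slit)
    (hq : q.1.1 ∈ (trivializationAt ℝ L.fiber x).baseSet) :
    (slitFiberCoord x (t • q) : ℝ) = ((t * slitFiberCoord x q : ℝˣ) : ℝ) := by
  rw [Units.val_mul, slitFiberCoord_val (q := t • q) hq, slitFiberCoord_val hq]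
  exact dualCoord_smul x t q

theorem contMDiff_lift (s : L.Sections) :
    ContMDiff (L.base.I.prod 𝓘(ℝ, ℝ →L[ℝ] ℝ)) 𝓘(ℝ, ℝ) ∞
      (fun q : L.slit ↦ (q.1.2 (s q.1.1) : ℝ)) := by
  intro q
  have hq : q.1.1 ∈ (trivializationAt ℝ L.fiber q.1.1).baseSet :=
    mem_baseSet_trivializationAt ℝ L.fiber q.1.1
  have h1 := ((contMDiffAt_line_iff (x₀ := q.1.1) (f := fun x ↦ (⟨x, s x⟩ :
    TotalSpace ℝ L.fiber)) hq).1 (s.contMDiff.contMDiffAt)).2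
  have h2 := h1.comp q (contMDiff_slit_proj (L := L)).contMDiffAt
  refine (h2.mul (contMDiffAt_slit_coord hq)).congr_of_eventuallyEq ?_
  filter_upwards [contMDiff_slit_proj.continuous.continuousAt.preimage_mem_nhds
    ((trivializationAt ℝ L.fiber q.1.1).open_baseSet.mem_nhds hq)] with p hp
  conv_lhs => rw [eq_smul_lineFrame hp (s p.1.1), map_smul]
  rfl

/-- The map `ε ↦ ε ∘ F_x⁻¹` from `L₁^* ∖ 0` to `L₂^* ∖ 0`. -/
def slitMapFun {L₁ L₂ : LineBundle} (F : Hom L₁ L₂) (q : L₁.slit) : L₂.slit :=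
  slitMk (F.base q.1.1)
    (q.1.2.comp ((F.fiber q.1.1).symm : L₂.fiber (F.base q.1.1) →L[ℝ] L₁.fiber q.1.1)) (by
      intro h
      refine q.2 (ContinuousLinearMap.ext fun v ↦ ?_)
      have h' := DFunLike.congr_fun h (F.fiber q.1.1 v)
      change q.1.2 ((F.fiber q.1.1).symm (F.fiber q.1.1 v)) = 0 at h'
      rwa [ContinuousLinearEquiv.symm_apply_apply] at h')

theorem contMDiff_slitMapFun {L₁ L₂ : LineBundle} (F : Hom L₁ L₂) :
    ContMDiff (L₁.base.I.prod 𝓘(ℝ, ℝ →L[ℝ] ℝ)) (L₂.base.I.prod 𝓘(ℝ, ℝ →L[ℝ] ℝ)) ∞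
      (slitMapFun F) := by
  intro q
  have hq : q.1.1 ∈ (trivializationAt ℝ L₁.fiber q.1.1).baseSet :=
    mem_baseSet_trivializationAt ℝ L₁.fiber q.1.1
  have hq' : F.base q.1.1 ∈ (trivializationAt ℝ L₂.fiber (F.base q.1.1)).baseSet :=
    mem_baseSet_trivializationAt ℝ L₂.fiber (F.base q.1.1)
  refine (contMDiffAt_slit_iff (f := slitMapFun F) (x₀ := F.base q.1.1) hq').2
    ⟨(F.base.contMDiff.comp contMDiff_slit_proj).contMDiffAt, ?_⟩
  have h2 := ((F.contMDiffAt_coeff q.1.1).inv₀ (F.coeff_ne_zero hq hq')).comp q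
    (contMDiff_slit_proj (L := L₁)).contMDiffAt
  refine (h2.mul (contMDiffAt_slit_coord hq)).congr_of_eventuallyEq ?_
  filter_upwards [contMDiff_slit_proj.continuous.continuousAt.eventually
    (F.eventually_mem q.1.1)] with p hp
  change p.1.2 ((F.fiber p.1.1).symm
    (lineFrame L₂.fiber (F.base q.1.1) (F.base p.1.1))) = _
  rw [F.fiber_symm_lineFrame hp.1 hp.2, map_smul]
  rfl

variable (L)

/-- The manifold underlying `L^* ∖ 0`. -/
def slitManifold : SmoothManifold where
  carrier := L.slit
  E := L.base.E × (ℝ →L[ℝ] ℝ)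
  H := ModelProd L.base.H (ℝ →L[ℝ] ℝ)
  I := L.base.I.prod 𝓘(ℝ, ℝ →L[ℝ] ℝ)
  t2Space := t2Space_of_trivializations contMDiff_slit_proj.continuous fun x ↦
    ⟨slitTrivialization x, mem_baseSet_trivializationAt ℝ L.fiber x⟩
  secondCountable := have := Units.isOpenEmbedding_val (R := ℝ) |>.isEmbedding.secondCountableTopology
    secondCountable_of_trivializations fun x ↦
    ⟨slitTrivialization x, mem_baseSet_trivializationAt ℝ L.fiber x⟩

/-- The principal `ℝ^*`-bundle `L̃ = L^* ∖ 0`, on which `ℝ^*` acts by scalar multiplication. -/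
def slitDual : HomogeneousManifold where
  base := L.base
  total := L.slitManifold
  proj q := q.1.1
  action := slitAction
  contMDiffSMul := slitContMDiffSMul
  contMDiff_proj := contMDiff_slit_proj
  proj_smul _ _ := rfl
  exists_trivialization x := by
    refine ⟨slitTrivialization x, mem_baseSet_trivializationAt ℝ L.fiber x,
      fun q hq ↦ (contMDiffAt_slitCoord hq).contMDiffWithinAt,
      fun a ha ↦ (contMDiffAt_slitSymm ha.1).contMDiffWithinAt, fun t q hq ↦ ?_⟩
    refine Prod.ext rfl (Units.ext ?_)
    exact slitFiberCoord_smul x t q hq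

variable {L}

/-- The degree `1` function `λ̃` on `L̃` of a section `λ`: `λ̃(ε) = ⟨ε, λ_x⟩` for `ε ∈ L_x^* ∖ 0`. -/
def lift (s : L.Sections) : L.slitDual.total.Fun :=
  ⟨fun q : L.slit ↦ q.1.2 (s q.1.1), contMDiff_lift s⟩

/-- The equivariant map `L̃₁ → L̃₂` induced by a line bundle map `F : L₁ → L₂`:
it sends `ε ∈ L₁,ₓ^*` to `ε ∘ F_x⁻¹`. -/
def slitDualMap {L₁ L₂ : LineBundle} (F : Hom L₁ L₂) :
    HomogeneousManifold.Hom L₁.slitDual L₂.slitDual where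
  toMap := ⟨slitMapFun F, contMDiff_slitMapFun F⟩
  map_smul _ _ := rfl

end LineBundle

/-- A Jacobi bracket on a line bundle: a Lie bracket on sections that is a derivation in each
argument. -/
@[ext]
structure JacobiBracket (L : LineBundle) where
  bracket : L.Sections →ₗ[ℝ] L.Sections →ₗ[ℝ] L.Sections
  bracket_self : ∀ s, bracket s s = 0
  jacobi : ∀ s₁ s₂ s₃, bracket s₁ (bracket s₂ s₃) + bracket s₂ (bracket s₃ s₁) +
    bracket s₃ (bracket s₁ s₂) = 0
  isDerivation_left : ∀ s, LineBundle.IsDerivation (bracket.flip s)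
  isDerivation_right : ∀ s, LineBundle.IsDerivation (bracket s)

/-- A Poisson bracket on a manifold: a Lie bracket on smooth functions that is a derivation in
each argument. -/
@[ext]
structure PoissonBracket (N : SmoothManifold) where
  bracket : N.Fun →ₗ[ℝ] N.Fun →ₗ[ℝ] N.Fun
  bracket_self : ∀ f, bracket f f = 0
  jacobi : ∀ f₁ f₂ f₃, bracket f₁ (bracket f₂ f₃) + bracket f₂ (bracket f₃ f₁) +
    bracket f₃ (bracket f₁ f₂) = 0
  leibniz_left : ∀ f g k, bracket (f * g) k = f * bracket g k + g * bracket f k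
  leibniz_right : ∀ f g k, bracket f (g * k) = g * bracket f k + k * bracket f g

/-- A bracket on a homogeneous manifold is homogeneous of degree `-1` if
`h_t^* {f, g} = t⁻¹ {h_t^* f, h_t^* g}`. -/
def PoissonBracket.IsHomogeneous {P : HomogeneousManifold} (b : PoissonBracket P.total) : Prop :=
  ∀ (t : ℝˣ) (f g : P.total.Fun), SmoothManifold.pullback (P.h t) (b.bracket f g) =
    ((t : ℝ)⁻¹) • b.bracket (SmoothManifold.pullback (P.h t) f) (SmoothManifold.pullback (P.h t) g)

/-- The relation `{λ̃, μ̃}_{L̃} = (the lift of {λ, μ})` between a Jacobi bracket on `L` and a Poisson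
bracket on `L̃`. -/
def IsPoissonization {L : LineBundle} (J : JacobiBracket L)
    (b : PoissonBracket L.slitDual.total) : Prop :=
  ∀ s₁ s₂ : L.Sections, b.bracket (LineBundle.lift s₁) (LineBundle.lift s₂) =
    LineBundle.lift (J.bracket s₁ s₂)

/-- A fibre-wise invertible line bundle map is a Jacobi map if `F^*` preserves brackets. -/
def LineBundle.Hom.IsJacobi {L₁ L₂ : LineBundle} (F : LineBundle.Hom L₁ L₂)
    (J₁ : JacobiBracket L₁) (J₂ : JacobiBracket L₂) : Prop :=
  ∀ s₁ s₂ : L₂.Sections,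
    J₁.bracket (F.pullback s₁) (F.pullback s₂) = F.pullback (J₂.bracket s₁ s₂)

/-- A smooth map is a Poisson map if `Φ^*` preserves brackets. -/
def SmoothManifold.IsPoissonMap {M N : SmoothManifold} (Φ : M.Map N)
    (b₁ : PoissonBracket M) (b₂ : PoissonBracket N) : Prop :=
  ∀ f g : N.Fun, b₁.bracket (pullback Φ f) (pullback Φ g) = pullback Φ (b₂.bracket f g)

/-- A Jacobi manifold: a manifold equipped with a Jacobi bundle. -/
structure JacobiManifold where
  line : LineBundle
  jacobi : JacobiBracket line

/-- A homogeneous Poisson manifold: a homogeneous manifold equipped with a Poisson bracket that is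
homogeneous of degree `-1`. -/
structure HomogeneousPoissonManifold where
  manifold : HomogeneousManifold
  poisson : PoissonBracket manifold.total
  isHomogeneous : poisson.IsHomogeneous

/-- The category of Jacobi manifolds and Jacobi maps. -/
instance : CategoryTheory.Category JacobiManifold where
  Hom A B := {F : LineBundle.Hom A.line B.line // F.IsJacobi A.jacobi B.jacobi}
  id A := ⟨LineBundle.Hom.id A.line, fun _ _ ↦ rfl⟩
  comp F G := ⟨G.1.comp F.1, fun s₁ s₂ ↦
    (F.2 (G.1.pullback s₁) (G.1.pullback s₂)).trans (congrArg F.1.pullback (G.2 s₁ s₂))⟩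

/-- The category of homogeneous Poisson manifolds and `ℝ^*`-equivariant Poisson maps. -/
instance : CategoryTheory.Category HomogeneousPoissonManifold where
  Hom A B := {Φ : HomogeneousManifold.Hom A.manifold B.manifold //
    SmoothManifold.IsPoissonMap Φ.toMap A.poisson B.poisson}
  id A := ⟨HomogeneousManifold.Hom.id A.manifold, fun _ _ ↦ rfl⟩
  comp Φ Ψ := ⟨Ψ.1.comp Φ.1, fun f g ↦
    (Φ.2 (SmoothManifold.pullback Ψ.1.toMap f) (SmoothManifold.pullback Ψ.1.toMap g)).trans
      (congrArg (SmoothManifold.pullback Φ.1.toMap) (Ψ.2 f g))⟩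

/-- The functor `(L, {-,-}) ↦ (L̃, Φ {-,-})`, `F ↦ (ε ↦ ε ∘ F_x⁻¹)` determined by an operation `Φ`
from Jacobi brackets on `L` to homogeneous Poisson brackets on `L̃` for which the maps induced by
Jacobi maps are Poisson. -/
def poissonizationFunctor
    (Φ : ∀ L : LineBundle, JacobiBracket L → {b : PoissonBracket L.slitDual.total //
      b.IsHomogeneous})
    (hΦ : ∀ (A B : JacobiManifold) (F : A ⟶ B), SmoothManifold.IsPoissonMap
      (LineBundle.slitDualMap F.1).toMap (Φ A.line A.jacobi).1 (Φ B.line B.jacobi).1) :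
    CategoryTheory.Functor JacobiManifold HomogeneousPoissonManifold where
  obj A := ⟨A.line.slitDual, (Φ A.line A.jacobi).1, (Φ A.line A.jacobi).2⟩
  map {A B} F := ⟨LineBundle.slitDualMap F.1, hΦ A B F⟩
  map_id _ := rfl
  map_comp _ _ := rfl

end

/-! A bracket that is a derivation in each argument sees only the differentials of its arguments. On
`L̃` the differentials of the lifts `λ̃` span every cotangent space: if `u` is the lift of a local
frame and `ξ_i` are coordinates of the base, then `u` and the products `ξ_i u` are lifts, and since
`u ≠ 0` their differentials form a coframe (`exists_lift_coframe`). A Poisson bracket on `L̃` is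
therefore determined by its values on lifts, and every identity between biderivations can be tested
there. Uniqueness, homogeneity and the Poisson property of `F̃` all follow in this way.

For existence, put `{f, g}(q) = {λ, μ}~(q)` for any sections with `df = dλ̃` and `dg = dμ̃` at `q`.
This is well defined because `dλ̃ = 0` at `q` says exactly that the 1-jet of `λ` vanishes at the
base point, and a derivation of `L` is a first order operator (`IsDerivation.lift_eq_zero`).
Smoothness follows by expanding in a local coframe of lifts. The Jacobiator is a derivation in each
argument and vanishes on lifts, hence vanishes.

Conversely, lifts are the functions of degree `1` and pull-backs from the base are those of degree
`0`. A bracket of degree `-1` sends two lifts to a lift, and a lift and a pull-back to a pull-back.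
The first gives the bracket of sections; the second gives the vector field required of a derivation
of `L`, because derivations of the algebra of functions are vector fields. That fact, and the
dependence on differentials alone, rest on Hadamard's lemma.

For the equivalence of categories, each fibre of `L̃` is one `ℝ^*`-orbit, so an equivariant map is
prescribed fibrewise by the image of one covector and comes from a unique line bundle map. Every
principal `ℝ^*`-bundle `P` is isomorphic to the slit dual of a line bundle whose cocycle is read off
from the local trivializations of `P`; the Poisson bracket is transported along this isomorphism. -/

noncomputable section

/-! ### Hadamard's lemma and smoothness of parametric integrals -/

section Hadamard

variable {E V : Type} [NormedAddCommGroup E] [NormedSpace ℝ E] [FiniteDimensional ℝ E]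
  [NormedAddCommGroup V] [NormedSpace ℝ V] [CompleteSpace V]

/-- Differentiation under the integral sign: the partial derivative is continuous, hence bounded on
the compact product of the closed unit ball around `y` with `[0, 1]`, and this constant dominates.
-/
theorem hasFDerivAt_intervalIntegral_of_contDiff {K : E × ℝ → V} (hK : ContDiff ℝ 1 K) (y : E) :
    HasFDerivAt (fun y ↦ ∫ t in (0 : ℝ)..1, K (y, t))
      (∫ t in (0 : ℝ)..1, (fderiv ℝ K (y, t)).comp (ContinuousLinearMap.inl ℝ E ℝ)) y := by
  have hK' : Continuous fun p : E × ℝ ↦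
      (fderiv ℝ K p).comp (ContinuousLinearMap.inl ℝ E ℝ) :=
    (hK.continuous_fderiv one_ne_zero).clm_comp continuous_const
  obtain ⟨C, hC⟩ := ((isCompact_closedBall y 1).prod
    (isCompact_Icc (a := (0 : ℝ)) (b := 1))).exists_bound_of_continuousOn hK'.continuousOn
  refine (intervalIntegral.hasFDerivAt_integral_of_dominated_of_fderiv_le (𝕜 := ℝ)
    (bound := fun _ ↦ C) (s := Metric.ball y 1)
    (F := fun y t ↦ K (y, t))
    (F' := fun y t ↦ (fderiv ℝ K (y, t)).comp (ContinuousLinearMap.inl ℝ E ℝ))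
    (Metric.ball_mem_nhds y one_pos) ?_ ?_ ?_ ?_ ?_ ?_)
  · exact Filter.Eventually.of_forall fun z ↦
      (hK.continuous.comp (by fun_prop : Continuous fun t : ℝ ↦ (z, t))).aestronglyMeasurable
  · exact (hK.continuous.comp
      (by fun_prop : Continuous fun t : ℝ ↦ (y, t))).intervalIntegrable _ _
  · exact (hK'.comp (by fun_prop : Continuous fun t : ℝ ↦ (y, t))).aestronglyMeasurable
  · refine Filter.Eventually.of_forall fun t ht z hz ↦
      hC (z, t) ⟨Metric.ball_subset_closedBall hz, ?_⟩
    rw [Set.uIoc_of_le zero_le_one] at ht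
    exact ⟨ht.1.le, ht.2⟩
  · exact intervalIntegrable_const
  · refine Filter.Eventually.of_forall fun t _ z _ ↦ ?_
    have h1 := (hK.differentiable one_ne_zero (z, t)).hasFDerivAt
    exact h1.comp z (hasFDerivAt_prodMk_left z t)

/-- The derivative of such an integral is an integral of the same kind, with values in `E →L[ℝ] V`.
The target space is therefore quantified inside the induction. -/
theorem contDiff_nat_intervalIntegral (n : ℕ) : ∀ {V : Type} [NormedAddCommGroup V]
    [NormedSpace ℝ V] [CompleteSpace V] {K : E × ℝ → V}, ContDiff ℝ n K →
    ContDiff ℝ n (fun y ↦ ∫ t in (0 : ℝ)..1, K (y, t)) := by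
  induction n with
  | zero =>
    intro V _ _ _ K hK
    refine contDiff_zero.2 ?_
    exact intervalIntegral.continuous_parametric_intervalIntegral_of_continuous'
      (f := fun y t ↦ K (y, t)) hK.continuous 0 1
  | succ n ih =>
    intro V _ _ _ K hK
    have h1 : ContDiff ℝ 1 K := hK.of_le (by norm_cast; omega)
    have hK' : ContDiff ℝ n fun p : E × ℝ ↦
        (fderiv ℝ K p).comp (ContinuousLinearMap.inl ℝ E ℝ) :=
      (hK.fderiv_right (m := n) (by norm_cast)).clm_comp contDiff_const
    refine contDiff_succ_iff_hasFDerivAt.2 ⟨_, ih hK', fun y ↦ ?_⟩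
    exact hasFDerivAt_intervalIntegral_of_contDiff h1 y

/-- **Hadamard's lemma**: a smooth function is its value at a point plus a combination of the centred
coordinates whose smooth coefficients take the values of the partial derivatives there. -/
theorem exists_hadamard {ι : Type} [Fintype ι] (b : Module.Basis ι ℝ E) {F : E → ℝ}
    (hF : ContDiff ℝ ∞ F) (y₀ : E) : ∃ g : ι → E → ℝ, (∀ i, ContDiff ℝ ∞ (g i)) ∧
      (∀ i, g i y₀ = fderiv ℝ F y₀ (b i)) ∧
      ∀ y, F y = F y₀ + ∑ i, b.repr (y - y₀) i * g i y := by
  have hF' : ContDiff ℝ ∞ (fderiv ℝ F) := hF.fderiv_right (by simp)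
  have hp : ContDiff ℝ ∞ fun p : E × ℝ ↦ y₀ + p.2 • (p.1 - y₀) := by fun_prop
  -- The coefficients average the partial derivatives along the segment from `y₀` to `y`; the
  -- expansion is the fundamental theorem of calculus on that segment.
  refine ⟨fun i y ↦ ∫ t in (0 : ℝ)..1, fderiv ℝ F (y₀ + t • (y - y₀)) (b i), fun i ↦ ?_, fun i ↦ ?_,
    fun y ↦ ?_⟩
  · refine contDiff_infty.2 fun n ↦ ?_
    refine contDiff_nat_intervalIntegral n
      (K := fun p : E × ℝ ↦ fderiv ℝ F (y₀ + p.2 • (p.1 - y₀)) (b i)) ?_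
    exact ((hF'.comp hp).clm_apply contDiff_const).of_le (by exact_mod_cast le_top)
  · simp
  · have hd : ∀ t : ℝ, HasDerivAt (fun t : ℝ ↦ F (y₀ + t • (y - y₀)))
        (fderiv ℝ F (y₀ + t • (y - y₀)) (y - y₀)) t := fun t ↦ by
      have h1 := (hF.differentiable (by simp) (y₀ + t • (y - y₀))).hasFDerivAt
      have h2 : HasDerivAt (fun t : ℝ ↦ y₀ + t • (y - y₀)) (y - y₀) t := by
        simpa using ((hasDerivAt_id t).smul_const (y - y₀)).const_add y₀
      exact h1.comp_hasDerivAt t h2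
    have hc : ∀ v, Continuous fun t : ℝ ↦ fderiv ℝ F (y₀ + t • (y - y₀)) v := fun v ↦
      (hF'.continuous.comp (by fun_prop)).clm_apply continuous_const
    have h := intervalIntegral.integral_eq_sub_of_hasDerivAt (a := 0) (b := 1) (fun t _ ↦ hd t)
      ((hc _).intervalIntegrable _ _)
    have h2 : ∀ A : E →L[ℝ] ℝ, A (y - y₀) = ∑ i, b.repr (y - y₀) i * A (b i) := fun A ↦ by
      conv_lhs => rw [← b.sum_repr (y - y₀), map_sum]
      simp only [map_smul, smul_eq_mul]
    simp_rw [h2] at h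
    rw [intervalIntegral.integral_finsetSum
      (fun i _ ↦ ((hc _).const_mul _).intervalIntegrable _ _)] at h
    simp only [intervalIntegral.integral_const_mul, one_smul, zero_smul, add_zero,
      add_sub_cancel] at h
    linarith

end Hadamard

/-! ### Differentials of functions, cutoffs and coordinates -/

namespace SmoothManifold

variable {N : SmoothManifold}

/-- The differential of a smooth function at a point. -/
def d (f : N.Fun) (q : N) : N.E →L[ℝ] ℝ := mfderiv N.I 𝓘(ℝ, ℝ) f q

theorem mdifferentiableAt (f : N.Fun) (q : N) : MDifferentiableAt N.I 𝓘(ℝ, ℝ) f q :=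
  f.contMDiff.mdifferentiable (by simp) q

theorem hasMFDerivAt_d (f : N.Fun) (q : N) : HasMFDerivAt N.I 𝓘(ℝ, ℝ) f q (d f q) :=
  (mdifferentiableAt f q).hasMFDerivAt

theorem d_eq_of_hasMFDerivAt {f : N.Fun} {q : N} {A : N.E →L[ℝ] ℝ}
    (h : HasMFDerivAt N.I 𝓘(ℝ, ℝ) f q A) : d f q = A := h.mfderiv

theorem d_add (f g : N.Fun) (q : N) : d (f + g) q = d f q + d g q :=
  ((hasMFDerivAt_d f q).add (hasMFDerivAt_d g q)).mfderiv

theorem d_smul (c : ℝ) (f : N.Fun) (q : N) : d (c • f) q = c • d f q :=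
  ((hasMFDerivAt_d f q).const_smul c).mfderiv

theorem d_mul (f g : N.Fun) (q : N) : d (f * g) q = f q • d g q + g q • d f q :=
  ((hasMFDerivAt_d f q).mul (hasMFDerivAt_d g q)).mfderiv

/-- The differential at a point, as a linear map on functions. -/
def dLin (q : N) : N.Fun →ₗ[ℝ] N.E →L[ℝ] ℝ where
  toFun f := d f q
  map_add' f g := d_add f g q
  map_smul' c f := d_smul c f q

theorem d_sum {ι : Type} (s : Finset ι) (f : ι → N.Fun) (q : N) :
    d (∑ i ∈ s, f i) q = ∑ i ∈ s, d (f i) q := map_sum (dLin q) f s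

/-- Evaluation at a point, as a linear map on functions. -/
def evalLin (q : N) : N.Fun →ₗ[ℝ] ℝ where
  toFun f := f q
  map_add' _ _ := rfl
  map_smul' _ _ := rfl

theorem d_sub (f g : N.Fun) (q : N) : d (f - g) q = d f q - d g q := map_sub (dLin q) f g

/-- The differential of a smooth map at a point. -/
def dMap {N' : SmoothManifold} (Φ : N.Map N') (q : N) : N.E →L[ℝ] N'.E := mfderiv N.I N'.I Φ q

theorem d_pullback {N' : SmoothManifold} (Φ : N.Map N') (f : N'.Fun) (q : N) :
    d (pullback Φ f) q = (d f (Φ q)).comp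
      (dMap Φ q) :=
  ((hasMFDerivAt_d f (Φ q)).comp q
    (Φ.contMDiff.mdifferentiable (by simp) q).hasMFDerivAt).mfderiv

theorem exists_cutoff {q : N} {U : Set N} (hU : U ∈ 𝓝 q) :
    ∃ χ : N.Fun, (∀ᶠ p in 𝓝 q, χ p = 1) ∧ tsupport χ ⊆ U := by
  obtain ⟨χ, -, hχ⟩ := (SmoothBumpFunction.nhds_basis_tsupport (I := N.I) q).mem_iff.1 hU
  exact ⟨⟨χ, χ.contMDiff⟩, χ.eventuallyEq_one, hχ⟩

/-- Multiplication by a cutoff realises a smooth germ by a global function, so that brackets and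
derivations, defined only on global functions, can be applied to local coordinates. -/
theorem exists_fun_eventuallyEq {q : N} {U : Set N} (hU : IsOpen U) (hq : q ∈ U) {f : N → ℝ}
    (hf : ContMDiffOn N.I 𝓘(ℝ, ℝ) ∞ f U) : ∃ g : N.Fun, (g : N → ℝ) =ᶠ[𝓝 q] f := by
  obtain ⟨χ, h1, hχ⟩ := exists_cutoff (hU.mem_nhds hq)
  refine ⟨⟨fun p ↦ χ p * f p, contMDiff_of_tsupport fun p hp ↦ ?_⟩, ?_⟩
  · exact χ.contMDiff.contMDiffAt.mul (hf.contMDiffAt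
      (hU.mem_nhds (hχ (tsupport_mul_subset_left hp))))
  · filter_upwards [h1] with p hp
    change χ p * f p = f p
    rw [hp, one_mul]

/-- The chart at a point as a map into the model vector space. -/
abbrev chart (q₀ : N) : PartialEquiv N N.E := extChartAt N.I q₀

theorem contMDiffOn_comp_chart {q₀ : N} {F : N.E → ℝ} (hF : ContDiff ℝ ∞ F) :
    ContMDiffOn N.I 𝓘(ℝ, ℝ) ∞ (fun q ↦ F (chart q₀ q)) (chart q₀).source := by
  rw [chart, extChartAt_source]
  exact hF.contMDiff.comp_contMDiffOn contMDiffOn_extChartAt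

theorem contDiffOn_comp_chart_symm (f : N.Fun) (q₀ : N) :
    ContDiffOn ℝ ∞ (f ∘ (chart q₀).symm) (chart q₀).target :=
  contMDiffOn_iff_contDiffOn.1 (f.contMDiff.comp_contMDiffOn (contMDiffOn_extChartAt_symm q₀))

/-- The differential of a chart. -/
def dChart (q₀ q : N) : N.E →L[ℝ] N.E := mfderiv N.I 𝓘(ℝ, N.E) (chart q₀) q

theorem hasMFDerivAt_chart {q₀ q : N} (hq : q ∈ (chart q₀).source) :
    HasMFDerivAt N.I 𝓘(ℝ, N.E) (chart q₀) q (dChart q₀ q) := by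
  rw [chart, extChartAt_source] at hq
  exact (mdifferentiableAt_extChartAt hq).hasMFDerivAt

theorem d_eq_of_comp_chart {f : N.Fun} {q₀ q : N} {F : N.E → ℝ} (hq : q ∈ (chart q₀).source)
    (hF : DifferentiableAt ℝ F (chart q₀ q))
    (h : (f : N → ℝ) =ᶠ[𝓝 q] fun p ↦ F (chart q₀ p)) :
    d f q = (fderiv ℝ F (chart q₀ q)).comp (dChart q₀ q) := by
  refine d_eq_of_hasMFDerivAt (HasMFDerivAt.congr_of_eventuallyEq ?_ h)
  exact hF.hasFDerivAt.hasMFDerivAt.comp q (hasMFDerivAt_chart hq)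

theorem d_eq_fderiv_chart (f : N.Fun) {q₀ q : N} (hq : q ∈ (chart q₀).source) :
    d f q = (fderiv ℝ (f ∘ (chart q₀).symm) (chart q₀ q)).comp (dChart q₀ q) := by
  refine d_eq_of_comp_chart hq ?_ ?_
  · exact ((contDiffOn_comp_chart_symm f q₀).contDiffAt ((isOpen_extChartAt_target q₀).mem_nhds
      ((chart q₀).map_source hq))).differentiableAt (by simp)
  · filter_upwards [(isOpen_extChartAt_source (I := N.I) q₀).mem_nhds hq] with p hp
    exact congrArg f ((chart q₀).left_inv hp).symm

theorem exists_coordinates {ι : Type} (b : Module.Basis ι ℝ N.E) (q₀ : N) :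
    ∃ x : ι → N.Fun, ∀ i, (x i : N → ℝ) =ᶠ[𝓝 q₀] fun q ↦ b.repr (chart q₀ q) i := by
  have h : ∀ i, ∃ g : N.Fun, (g : N → ℝ) =ᶠ[𝓝 q₀] fun q ↦ b.repr (chart q₀ q) i := fun i ↦
    exists_fun_eventuallyEq (isOpen_extChartAt_source q₀) (mem_extChartAt_source q₀)
      (contMDiffOn_comp_chart (F := fun y ↦ b.repr y i)
        (b.coord i).toContinuousLinearMap.contDiff)
  choose x hx using h
  exact ⟨x, hx⟩

theorem d_coordinate {ι : Type} {b : Module.Basis ι ℝ N.E} {q₀ q : N} {i : ι} {x : N.Fun}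
    (hq : q ∈ (chart q₀).source) (hx : (x : N → ℝ) =ᶠ[𝓝 q] fun q ↦ b.repr (chart q₀ q) i)
    (v : N.E) : d x q v = b.repr (dChart q₀ q v) i := by
  have h := d_eq_of_comp_chart (F := (b.coord i).toContinuousLinearMap) hq
    (ContinuousLinearMap.differentiableAt _) hx
  rw [h, ContinuousLinearMap.fderiv]
  rfl

theorem isInvertible_mfderiv_chart {q₀ q : N} (hq : q ∈ (chart q₀).source) :
    (dChart q₀ q).IsInvertible :=
  isInvertible_mfderiv_extChartAt hq

/-- Functions whose differentials at a point are the dual basis of a basis of the tangent space. -/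
theorem exists_dual_coordinates (q₀ : N) : ∃ (n : ℕ) (e : Module.Basis (Fin n) ℝ N.E)
    (x : Fin n → N.Fun), ∀ i v, d (x i) q₀ v = e.repr v i := by
  obtain ⟨A, hA⟩ := isInvertible_mfderiv_chart (mem_extChartAt_source (I := N.I) q₀)
  have b := Module.finBasis ℝ N.E
  obtain ⟨x, hx⟩ := exists_coordinates b q₀
  refine ⟨_, b.map A.symm.toLinearEquiv, x, fun i v ↦ ?_⟩
  rw [d_coordinate (mem_extChartAt_source q₀) (hx i), ← hA]
  rfl

/-! ### Point derivations are tangent vectors, derivations are vector fields -/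

/-- The derivations of the algebra of smooth functions at a point. -/
def IsPointDerivation (q : N) (D : N.Fun →ₗ[ℝ] ℝ) : Prop :=
  ∀ f g, D (f * g) = f q * D g + g q * D f

namespace IsPointDerivation

variable {q : N} {D : N.Fun →ₗ[ℝ] ℝ}

theorem map_one (hD : IsPointDerivation q D) : D 1 = 0 := by
  have h := hD 1 1
  rw [mul_one] at h
  change D 1 = 1 * D 1 + 1 * D 1 at h
  linarith

theorem map_const (hD : IsPointDerivation q D) (c : ℝ) : D (c • (1 : N.Fun)) = 0 := by
  rw [map_smul, hD.map_one, smul_zero]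

/-- Locality: with `χ` supported where `f` vanishes and `χ q = 1`, the product `χ * f` is zero, and
the Leibniz rule for it leaves `D f = 0`. -/
theorem map_eq_zero_of_eventuallyEq (hD : IsPointDerivation q D) {f : N.Fun}
    (hf : (f : N → ℝ) =ᶠ[𝓝 q] 0) : D f = 0 := by
  obtain ⟨χ, h1, hχ⟩ := exists_cutoff hf
  have h0 : χ * f = 0 := by
    ext p
    by_cases hp : p ∈ tsupport χ
    · change χ p * f p = 0
      rw [show f p = 0 from hχ hp, mul_zero]
    · change χ p * f p = 0
      rw [image_eq_zero_of_notMem_tsupport hp, zero_mul]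
  have h := hD χ f
  rw [h0, map_zero, h1.self_of_nhds, show f q = 0 from hf.self_of_nhds] at h
  linarith

theorem congr (hD : IsPointDerivation q D) {f g : N.Fun} (h : (f : N → ℝ) =ᶠ[𝓝 q] g) :
    D f = D g := by
  rw [← sub_eq_zero, ← map_sub]
  refine hD.map_eq_zero_of_eventuallyEq ?_
  filter_upwards [h] with p hp
  change f p - g p = 0
  rw [hp, sub_self]

/-- A derivation at a point kills the functions with vanishing differential there. -/
theorem map_eq_zero (hD : IsPointDerivation q D) {f : N.Fun} (hf : d f q = 0) : D f = 0 := by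
  have hy : chart q q ∈ (chart q).target := mem_extChartAt_target q
  -- The bump function extends the local representative of `f` to a smooth function on the whole
  -- model space, where segments from the centre are available for Hadamard's lemma.
  obtain ⟨ψ, hψ⟩ : ∃ ψ : ContDiffBump (chart q q), tsupport ψ ⊆ (chart q).target := by
    obtain ⟨r, hr, hb⟩ := Metric.nhds_basis_closedBall.mem_iff.1
      ((isOpen_extChartAt_target q).mem_nhds hy)
    exact ⟨⟨r / 2, r, half_pos hr, half_lt_self hr⟩, by rwa [ContDiffBump.tsupport_eq]⟩
  set F : N.E → ℝ := fun y ↦ ψ y * (f ∘ (chart q).symm) y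
  have hF : ContDiff ℝ ∞ F := by
    refine contMDiff_iff_contDiff.1 (contMDiff_of_tsupport fun y hy ↦ ?_)
    refine (ψ.contDiff.contDiffAt.mul ((contDiffOn_comp_chart_symm f q).contDiffAt
      ((isOpen_extChartAt_target q).mem_nhds
        (hψ (tsupport_mul_subset_left hy))))).contMDiffAt
  have hfF : (f : N → ℝ) =ᶠ[𝓝 q] fun p ↦ F (chart q p) := by
    filter_upwards [extChartAt_source_mem_nhds (I := N.I) q,
      (continuousAt_extChartAt (I := N.I) q).eventually ψ.eventuallyEq_one] with p hp hp1
    change f p = ψ (chart q p) * f ((chart q).symm (chart q p))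
    rw [(chart q).left_inv hp, show ψ (chart q p) = 1 from hp1, one_mul]
  have hF0 : fderiv ℝ F (chart q q) = 0 := by
    have h := d_eq_of_comp_chart (mem_extChartAt_source q) (hF.differentiable (by simp) _) hfF
    obtain ⟨A, hA⟩ := isInvertible_mfderiv_chart (mem_extChartAt_source (I := N.I) q)
    rw [hf, ← hA] at h
    ext v
    have h' := DFunLike.congr_fun h (A.symm v)
    rw [ContinuousLinearMap.comp_apply, ContinuousLinearEquiv.coe_coe,
      A.apply_symm_apply] at h'
    exact h'.symm
  have b := Module.finBasis ℝ N.E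
  obtain ⟨g, hg, hg0, hFg⟩ := exists_hadamard b hF (chart q q)
  have hx : ∀ i, ∃ x : N.Fun, (x : N → ℝ) =ᶠ[𝓝 q] fun p ↦ b.repr (chart q p - chart q q) i :=
    fun i ↦ exists_fun_eventuallyEq (isOpen_extChartAt_source q) (mem_extChartAt_source q)
      (contMDiffOn_comp_chart (F := fun y ↦ b.repr (y - chart q q) i)
        ((b.coord i).toContinuousLinearMap.contDiff.comp (contDiff_id.sub contDiff_const)))
  have hG : ∀ i, ∃ x : N.Fun, (x : N → ℝ) =ᶠ[𝓝 q] fun p ↦ g i (chart q p) := fun i ↦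
    exists_fun_eventuallyEq (isOpen_extChartAt_source q) (mem_extChartAt_source q)
      (contMDiffOn_comp_chart (hg i))
  choose x hx using hx
  choose G hG using hG
  -- Near `q`, `f` is a constant plus a sum of products in which both factors vanish at `q`: the
  -- centred coordinates by construction, the coefficients because the differential of `F` is zero.
  -- The Leibniz rule kills each product.
  have key : (f : N → ℝ) =ᶠ[𝓝 q] (F (chart q q) • (1 : N.Fun) + ∑ i, x i * G i : N.Fun) := by
    filter_upwards [hfF, Filter.eventually_all.2 hx, Filter.eventually_all.2 hG] with p h1 h2 h3
    rw [h1, hFg]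
    have : (∑ i, x i * G i : N.Fun) p = ∑ i, x i p * G i p := by
      exact map_sum (evalLin p) _ _
    change _ = F (chart q q) * 1 + (∑ i, x i * G i : N.Fun) p
    rw [this, mul_one]
    simp only [h2, h3]
  rw [hD.congr key, map_add, hD.map_const, map_sum, zero_add]
  refine Finset.sum_eq_zero fun i _ ↦ ?_
  have hx0 : x i q = 0 := by rw [(hx i).self_of_nhds]; simp
  have hG0 : G i q = 0 := by
    rw [(hG i).self_of_nhds]
    change g i (chart q q) = 0
    rw [hg0, hF0]; rfl
  rw [hD, hx0, hG0, zero_mul, zero_mul, add_zero]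

theorem eq_of_d_eq (hD : IsPointDerivation q D) {f g : N.Fun} (h : d f q = d g q) :
    D f = D g := by
  rw [← sub_eq_zero, ← map_sub]
  exact hD.map_eq_zero (by rw [d_sub, h, sub_self])

/-- Since `D` depends only on the differential at `q`, `f` may be replaced by the combination of the
`x i` with the same differential. The coordinates of the tangent vector are then the numbers `D (x
i)`. -/
theorem exists_tangent (hD : IsPointDerivation q D) : ∃ v : N.E, ∀ f, D f = d f q v := by
  obtain ⟨n, e, x, hx⟩ := exists_dual_coordinates q
  refine ⟨∑ i, D (x i) • e i, fun f ↦ ?_⟩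
  have h : d f q = d (∑ i, d f q (e i) • x i) q := by
    ext v
    rw [d_sum, _root_.sum_apply]
    conv_lhs => rw [← e.sum_repr v, map_sum]
    refine Finset.sum_congr rfl fun i _ ↦ ?_
    rw [d_smul, _root_.smul_apply, hx, map_smul, smul_eq_mul, smul_eq_mul, mul_comm]
  rw [hD.eq_of_d_eq h, map_sum, map_sum]
  refine Finset.sum_congr rfl fun i _ ↦ ?_
  rw [map_smul, map_smul, smul_eq_mul, smul_eq_mul, mul_comm]

end IsPointDerivation

/-- Every derivation of the algebra of smooth functions is a smooth vector field. -/
theorem exists_vectorField (D : N.Fun →ₗ[ℝ] N.Fun) (hD : ∀ f g, D (f * g) = f * D g + g * D f) :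
    ∃ X : N.VectorField, ∀ f q, D f q = X.deriv f q := by
  have h : ∀ q : N, ∃ v : N.E, ∀ f, D f q = d f q v := fun q ↦
    IsPointDerivation.exists_tangent (q := q)
      (D := { toFun := fun f ↦ D f q
              map_add' := fun f g ↦ by rw [map_add]; rfl
              map_smul' := fun c f ↦ by rw [map_smul]; rfl })
      fun f g ↦ by
        change D (f * g) q = f q * D g q + g q * D f q
        rw [hD]; rfl
  choose X hX using h
  refine ⟨⟨fun q ↦ (X q : TangentSpace N.I q), fun q₀ ↦ ?_⟩, fun f q ↦ hX q f⟩
  refine (Bundle.contMDiffAt_section (E := fun q : N ↦ TangentSpace N.I q) (F := N.E)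
    (s := fun q ↦ (X q : TangentSpace N.I q)) q₀).2 ?_
  have b := Module.finBasis ℝ N.E
  obtain ⟨x, hx⟩ := exists_coordinates b q₀
  -- In the trivialization given by the chart at `q₀`, the components of `X` are the functions `D (x
  -- i)`, smooth by assumption. The `x i` have to agree with the chart coordinates around each
  -- nearby point, since their differentials there are used.
  have hs : ContMDiffAt N.I 𝓘(ℝ, N.E) ∞ (fun q ↦ ∑ i, D (x i) q • b i) q₀ := by
    refine ContMDiffAt.sum fun i _ ↦ ?_
    exact (D (x i)).contMDiff.contMDiffAt.smul contMDiffAt_const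
  refine hs.congr_of_eventuallyEq ?_
  filter_upwards [extChartAt_source_mem_nhds (I := N.I) q₀,
    Filter.eventually_all.2 fun i ↦ (hx i).eventually_nhds] with q hq hxq
  have h1 : (trivializationAt N.E (TangentSpace N.I) q₀ ⟨q, X q⟩).2 =
      dChart q₀ q (X q) := by
    have := TangentBundle.continuousLinearMapAt_trivializationAt (I := N.I) (x₀ := q₀) (x := q)
      (by rwa [← extChartAt_source N.I])
    have hq' : q ∈ (trivializationAt N.E (TangentSpace N.I) q₀).baseSet := by
      rwa [TangentBundle.trivializationAt_baseSet, ← extChartAt_source N.I]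
    rw [dChart, ← this]
    exact (Trivialization.continuousLinearMapAt_apply_of_mem _ _ hq' _).symm
  rw [h1]
  refine b.ext_elem fun i ↦ ?_
  rw [← d_coordinate hq (hxq i), ← hX]
  simp [Finsupp.single_apply]

/-- Functions whose differentials form a basis at a point form a smooth coframe around it. -/
theorem exists_eventually_d_eq_sum {ι : Type} [Fintype ι] [DecidableEq ι] (u : ι → N.Fun) (q₀ : N)
    (hu : Function.Bijective fun (v : N.E) (i : ι) ↦ d (u i) q₀ v) (f : N.Fun) :
    ∃ c : ι → N.Fun, ∀ᶠ q in 𝓝 q₀, d f q = ∑ i, c i q • d (u i) q := by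
  set U : N.E → ι → ℝ := fun y i ↦ u i ((chart q₀).symm y)
  have hT : IsOpen (chart q₀).target := isOpen_extChartAt_target q₀
  have hU : ContDiffOn ℝ ∞ U (chart q₀).target :=
    contDiffOn_pi.2 fun i ↦ contDiffOn_comp_chart_symm (u i) q₀
  have hU' : ContDiffOn ℝ ∞ (fderiv ℝ U) (chart q₀).target := hU.fderiv_of_isOpen hT (by simp)
  have hf' : ContDiffOn ℝ ∞ (fderiv ℝ (f ∘ (chart q₀).symm)) (chart q₀).target :=
    (contDiffOn_comp_chart_symm f q₀).fderiv_of_isOpen hT (by simp)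
  have hdU : ∀ {q}, q ∈ (chart q₀).source → ∀ v i, d (u i) q v =
      fderiv ℝ U (chart q₀ q) (dChart q₀ q v) i := by
    intro q hq v i
    have hd := (hU.contDiffAt (hT.mem_nhds ((chart q₀).map_source hq))).differentiableAt (by simp)
    rw [d_eq_fderiv_chart (u i) hq, ContinuousLinearMap.comp_apply]
    exact congrArg (fun A ↦ A (dChart q₀ q v)) (fderiv_apply hd i)
  have hq₀ : q₀ ∈ (chart q₀).source := mem_extChartAt_source q₀
  -- The locus where the local representative of `(u i)` has invertible derivative: open, because
  -- invertible operators form an open set, and containing the image of `q₀` by hypothesis.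
  set W : Set N.E := (chart q₀).target ∩ fderiv ℝ U ⁻¹'
    Set.range ((↑) : (N.E ≃L[ℝ] (ι → ℝ)) → N.E →L[ℝ] (ι → ℝ))
  have hWo : IsOpen W := hU'.continuousOn.isOpen_inter_preimage hT ContinuousLinearEquiv.isOpen
  have hWq : chart q₀ q₀ ∈ W := by
    refine ⟨mem_extChartAt_target q₀, ?_⟩
    obtain ⟨A, hA⟩ := isInvertible_mfderiv_chart hq₀
    have hb : Function.Bijective (fderiv ℝ U (chart q₀ q₀)) := by
      have : (fun (v : N.E) (i : ι) ↦ d (u i) q₀ v) = fderiv ℝ U (chart q₀ q₀) ∘ A := by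
        ext v i
        rw [hdU hq₀, ← hA]; rfl
      rw [this] at hu
      exact (Function.Bijective.of_comp_iff _ A.bijective).1 hu
    exact ⟨(LinearEquiv.ofBijective (fderiv ℝ U (chart q₀ q₀) : N.E →ₗ[ℝ] (ι → ℝ))
      hb).toContinuousLinearEquiv, rfl⟩
  -- Solving for the coefficients gives `df ∘ dU⁻¹` on the standard basis, smooth on `W` because
  -- inversion of operators is smooth at invertible ones.
  have hc : ∀ i, ∃ c : N.Fun, (c : N → ℝ) =ᶠ[𝓝 q₀] fun q ↦
      fderiv ℝ (f ∘ (chart q₀).symm) (chart q₀ q)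
        ((fderiv ℝ U (chart q₀ q)).inverse (Pi.single i 1)) := by
    intro i
    have hg : ContDiffOn ℝ ∞ (fun y ↦ fderiv ℝ (f ∘ (chart q₀).symm) y
        ((fderiv ℝ U y).inverse (Pi.single i 1))) W := by
      rintro y ⟨hy, A, hA⟩
      have hy' := hT.mem_nhds hy
      have h1 : ContDiffAt ℝ ∞ (fun y ↦ (fderiv ℝ U y).inverse) y := by
        have h0 := contDiffAt_map_inverse (n := ∞) A
        rw [hA] at h0
        exact h0.comp y (hU'.contDiffAt hy')
      exact ((hf'.contDiffAt hy').clm_apply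
        (h1.clm_apply contDiffAt_const)).contDiffWithinAt
    refine exists_fun_eventuallyEq (U := (chart q₀).source ∩ chart q₀ ⁻¹' W)
      ((continuousOn_extChartAt (I := N.I) q₀).isOpen_inter_preimage
        (isOpen_extChartAt_source q₀) hWo) ⟨hq₀, hWq⟩ ?_
    refine hg.contMDiffOn.comp (t := W) ?_ fun q hq ↦ hq.2
    refine (contMDiffOn_extChartAt (x := q₀)).mono fun q hq ↦ ?_
    rw [← extChartAt_source N.I]
    exact hq.1
  choose c hc using hc
  refine ⟨c, ?_⟩
  filter_upwards [Filter.eventually_all.2 hc, extChartAt_source_mem_nhds (I := N.I) q₀,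
    (continuousAt_extChartAt (I := N.I) q₀).preimage_mem_nhds (hWo.mem_nhds hWq)]
    with q hcq hq hqW
  ext v
  obtain ⟨A, hA⟩ := hqW.2
  rw [_root_.sum_apply]
  simp only [_root_.smul_apply, hcq, hdU hq, smul_eq_mul]
  rw [d_eq_fderiv_chart f hq]
  simp only [← hA, ContinuousLinearMap.inverse_equiv]
  rw [ContinuousLinearMap.comp_apply]
  set w : N.E := dChart q₀ q v
  have hw : w = ∑ i, A w i • A.symm (Pi.single i 1) := by
    rw [← A.symm_apply_apply w, ContinuousLinearEquiv.apply_symm_apply]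
    conv_lhs => rw [pi_eq_sum_univ' (A w), map_sum]
    simp only [map_smul]
  conv_lhs => rw [hw, map_sum]
  refine Finset.sum_congr rfl fun i _ ↦ ?_
  rw [map_smul, smul_eq_mul, mul_comm]
  rfl

end SmoothManifold

theorem HasMFDerivAt.comp_eq_zero {E E' H H' M M' : Type} [NormedAddCommGroup E] [NormedSpace ℝ E]
    [TopologicalSpace H] [NormedAddCommGroup E'] [NormedSpace ℝ E'] [TopologicalSpace H']
    {I : ModelWithCorners ℝ E H} {I' : ModelWithCorners ℝ E' H'} [TopologicalSpace M]
    [ChartedSpace H M] [TopologicalSpace M'] [ChartedSpace H' M'] {f : M' → ℝ} {g : M → M'} {p : M}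
    (hf : HasMFDerivAt I' 𝓘(ℝ, ℝ) f (g p) (0 : E' →L[ℝ] ℝ)) (hg : ContMDiffAt I I' ∞ g p) :
    HasMFDerivAt I 𝓘(ℝ, ℝ) (f ∘ g) p (0 : E →L[ℝ] ℝ) := by
  have h := hf.comp p (hg.mdifferentiableAt (by simp)).hasMFDerivAt
  refine h.congr_mfderiv ?_
  exact ContinuousLinearMap.zero_comp _

/-! ### Lifts of sections and their differentials -/

namespace LineBundle

open SmoothManifold

variable {L : LineBundle}

/-- The coordinate of a section with respect to a local frame. -/
def coord (s : L.Sections) (x₀ x : L.base) : ℝ := (trivializationAt ℝ L.fiber x₀ ⟨x, s x⟩).2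

theorem eq_coord_smul (s : L.Sections) {x₀ x : L.base}
    (hx : x ∈ (trivializationAt ℝ L.fiber x₀).baseSet) :
    s x = coord s x₀ x • lineFrame L.fiber x₀ x := eq_smul_lineFrame hx (s x)

theorem contMDiffAt_coord (s : L.Sections) {x₀ x : L.base}
    (hx : x ∈ (trivializationAt ℝ L.fiber x₀).baseSet) :
    ContMDiffAt L.base.I 𝓘(ℝ, ℝ) ∞ (coord s x₀) x :=
  ((contMDiffAt_line_iff (x₀ := x₀) (f := fun x ↦ (⟨x, s x⟩ : TotalSpace ℝ L.fiber)) hx).1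
    s.contMDiff.contMDiffAt).2

theorem exists_cutoff_frame (x₀ : L.base) : ∃ (χ : L.base.Fun) (s₀ : L.Sections),
    (∀ᶠ x in 𝓝 x₀, χ x = 1) ∧ tsupport χ ⊆ (trivializationAt ℝ L.fiber x₀).baseSet ∧
    ∀ x, s₀ x = χ x • lineFrame L.fiber x₀ x := by
  have ho := (trivializationAt ℝ L.fiber x₀).open_baseSet
  obtain ⟨χ, h1, hχ⟩ := exists_cutoff
    (ho.mem_nhds (mem_baseSet_trivializationAt ℝ L.fiber x₀))
  exact ⟨χ, ⟨fun x ↦ χ x • lineFrame L.fiber x₀ x,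
    ContMDiffOn.smul_section_of_tsupport χ.contMDiff.contMDiffOn ho hχ
      fun x hx ↦ (contMDiffAt_lineFrame L.fiber hx).contMDiffWithinAt⟩, h1, hχ, fun _ ↦ rfl⟩

/-- The projection of the slit dual, as a smooth map. -/
def slitProj : L.slitDual.total.Map L.base := ⟨fun q : L.slit ↦ q.1.1, contMDiff_slit_proj⟩

theorem lift_apply (s : L.Sections) (q : L.slit) : lift s q = (q.1.2 (s q.1.1) : ℝ) := rfl

theorem covector_apply {x₀ : L.base} {q : L.slit}
    (hq : q.1.1 ∈ (trivializationAt ℝ L.fiber x₀).baseSet) (v : L.fiber q.1.1) :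
    (q.1.2 v : ℝ) = (trivializationAt ℝ L.fiber x₀ ⟨q.1.1, v⟩).2 * dualCoord L.fiber x₀ q.1 := by
  conv_lhs => rw [eq_smul_lineFrame hq v, map_smul]
  rfl

theorem lift_eq_coord_mul (s : L.Sections) {x₀ : L.base} {q : L.slit}
    (hq : q.1.1 ∈ (trivializationAt ℝ L.fiber x₀).baseSet) :
    lift s q = coord s x₀ q.1.1 * dualCoord L.fiber x₀ q.1 := covector_apply hq (s q.1.1)

theorem lift_smulSection (f : L.base.Fun) (s : L.Sections) :
    lift (smulSection f s) = pullback slitProj f * lift s := by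
  ext q
  exact map_smul (q : L.slit).1.2 (f (q : L.slit).1.1) (s (q : L.slit).1.1)

variable (L) in
/-- The lift of sections, as a linear map. -/
def liftLin : L.Sections →ₗ[ℝ] L.slitDual.total.Fun where
  toFun := lift
  map_add' s t := by
    ext q
    exact map_add (q : L.slit).1.2 (s (q : L.slit).1.1) (t (q : L.slit).1.1)
  map_smul' c s := by
    ext q
    exact map_smul (q : L.slit).1.2 c (s (q : L.slit).1.1)

theorem lift_add (s t : L.Sections) : lift (s + t) = lift s + lift t := map_add (liftLin L) s t

theorem lift_smul (c : ℝ) (s : L.Sections) : lift (c • s) = c • lift s := map_smul (liftLin L) c s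

theorem lift_sub (s t : L.Sections) : lift (s - t) = lift s - lift t := map_sub (liftLin L) s t

theorem lift_zero : lift (0 : L.Sections) = 0 := map_zero (liftLin L)

theorem lift_sum {ι : Type} (a : Finset ι) (s : ι → L.Sections) :
    lift (∑ i ∈ a, s i) = ∑ i ∈ a, lift (s i) := map_sum (liftLin L) s a

/-- A nonzero covector, as an isomorphism of the fibre with `ℝ`. -/
def covectorEquiv (q : L.slit) : L.fiber q.1.1 ≃L[ℝ] ℝ :=
  ((trivializationAt ℝ L.fiber q.1.1).continuousLinearEquivAt ℝ q.1.1
    (mem_baseSet_trivializationAt ℝ L.fiber q.1.1)).trans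
    (ContinuousLinearEquiv.unitsEquivAut ℝ (slitFiberCoord q.1.1 q))

theorem covectorEquiv_apply (q : L.slit) (v : L.fiber q.1.1) :
    covectorEquiv q v = (q.1.2 v : ℝ) := by
  have hq := mem_baseSet_trivializationAt ℝ L.fiber q.1.1
  rw [covector_apply hq, ← slitFiberCoord_val hq]
  rfl

theorem section_eq_zero_of_lift_eq_zero {s : L.Sections} {q : L.slit} (h : lift s q = 0) :
    s q.1.1 = 0 :=
  (covectorEquiv q).map_eq_zero_iff.1 ((covectorEquiv_apply q _).trans h)

/-- The covector at a point dual to the local frame there. -/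
def slitPoint (x : L.base) : L.slit := slitSymm x (x, 1)

/-- A nonzero covector on a line is injective, and there is one over each point of the base. -/
theorem lift_injective : Function.Injective (lift (L := L)) := by
  intro s t h
  rw [← sub_eq_zero]
  ext x
  refine section_eq_zero_of_lift_eq_zero (s := s - t) (q := slitPoint x) ?_
  rw [lift_sub, h, sub_self]
  rfl

open Classical in
/-- The parametrization of the slit dual by the base and a real fibre coordinate, meaningful for
nonzero values of that coordinate. -/
def slitParam (x₀ : L.base) (a : L.base × ℝ) : L.slitDual.total :=
  slitSymm x₀ (a.1, if h : a.2 = 0 then 1 else Units.mk0 a.2 h)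

theorem dualCoord_slitParam {x₀ : L.base} {a : L.base × ℝ}
    (ha : a.1 ∈ (trivializationAt ℝ L.fiber x₀).baseSet) (h : a.2 ≠ 0) :
    dualCoord L.fiber x₀ (slitParam x₀ a : L.slit).1 = a.2 := by
  rw [slitParam, dualCoord_slitSymm ha, dif_neg h]
  rfl

theorem slit_ext {x₀ : L.base} {p q : L.slit}
    (hp : p.1.1 ∈ (trivializationAt ℝ L.fiber x₀).baseSet) (h : p.1.1 = q.1.1)
    (hd : dualCoord L.fiber x₀ p.1 = dualCoord L.fiber x₀ q.1) : p = q := by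
  obtain ⟨⟨x, ε⟩, hε⟩ := p
  obtain ⟨⟨y, ε'⟩, hε'⟩ := q
  obtain rfl : x = y := h
  have : ε = ε' := dual_ext (x₀ := x₀) hp hd
  subst this
  rfl

theorem slitParam_dualCoord {x₀ : L.base} {q : L.slit}
    (hq : q.1.1 ∈ (trivializationAt ℝ L.fiber x₀).baseSet) :
    slitParam x₀ (q.1.1, dualCoord L.fiber x₀ q.1) = q :=
  slit_ext (x₀ := x₀) hq rfl (dualCoord_slitParam hq (dualCoord_ne_zero hq q.2))

theorem contMDiffAt_slitParam {x₀ : L.base} {a : L.base × ℝ}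
    (ha : a.1 ∈ (trivializationAt ℝ L.fiber x₀).baseSet) (h : a.2 ≠ 0) :
    ContMDiffAt (L.base.I.prod 𝓘(ℝ, ℝ)) L.slitDual.total.I ∞ (slitParam x₀) a := by
  refine (contMDiffAt_slit_iff (f := slitParam x₀) (x₀ := x₀) ha).2 ⟨contMDiffAt_fst, ?_⟩
  refine (contMDiffAt_snd (I := L.base.I) (J := 𝓘(ℝ, ℝ))).congr_of_eventuallyEq ?_
  filter_upwards [(continuous_fst.continuousAt (x := a)).preimage_mem_nhds
      ((trivializationAt ℝ L.fiber x₀).open_baseSet.mem_nhds ha),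
    (continuous_snd.continuousAt (x := a)).eventually_ne h] with p hp hp'
  exact dualCoord_slitParam hp hp'

theorem lift_slitParam (s : L.Sections) {x₀ : L.base} {a : L.base × ℝ}
    (ha : a.1 ∈ (trivializationAt ℝ L.fiber x₀).baseSet) (h : a.2 ≠ 0) :
    lift s (slitParam x₀ a) = coord s x₀ a.1 * a.2 := by
  rw [lift_eq_coord_mul s (x₀ := x₀) (q := slitParam x₀ a) ha, dualCoord_slitParam ha h]
  rfl

/-! ### The differential of a lift encodes the 1-jet of the section -/

section VanishingDifferential

variable {s : L.Sections} {q : L.slit}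

theorem hasMFDerivAt_lift_eq_zero (h : d (lift s) q = 0) :
    HasMFDerivAt L.slitDual.total.I 𝓘(ℝ, ℝ) (lift s) (q : L.slitDual.total)
      (0 : L.slitDual.total.E →L[ℝ] ℝ) := by
  have h1 := hasMFDerivAt_d (lift s) q
  rwa [h] at h1

/-- Along the fibre the lift is the linear function `r ↦ coord s · r`, whose derivative is the value
of the section in the frame. -/
theorem coord_eq_zero_of_d_lift_eq_zero (h : d (lift s) q = 0) : coord s q.1.1 q.1.1 = 0 := by
  have hx := mem_baseSet_trivializationAt ℝ L.fiber q.1.1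
  have hr := dualCoord_ne_zero hx q.2
  set r := dualCoord L.fiber q.1.1 q.1
  have h0 := hasMFDerivAt_lift_eq_zero h
  rw [← slitParam_dualCoord hx] at h0
  have h1 := HasMFDerivAt.comp_eq_zero (I := 𝓘(ℝ, ℝ))
    (g := fun r : ℝ ↦ slitParam q.1.1 (q.1.1, r)) (p := r) h0
    ((contMDiffAt_slitParam (a := (q.1.1, r)) hx hr).comp r (contMDiffAt_const.prodMk contMDiffAt_id))
  have h2 : (fun r ↦ coord s q.1.1 q.1.1 * r) =ᶠ[𝓝 r]
      (lift s ∘ fun r : ℝ ↦ slitParam q.1.1 (q.1.1, r)) := by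
    filter_upwards [continuousAt_id.eventually_ne hr] with r hr
    exact (lift_slitParam s (a := (q.1.1, r)) hx hr).symm
  have h3 : HasFDerivAt (fun r ↦ coord s q.1.1 q.1.1 * r) (0 : ℝ →L[ℝ] ℝ) r :=
    (h1.congr_of_eventuallyEq h2).hasFDerivAt
  have h4 := ((hasDerivAt_id r).const_mul (coord s q.1.1 q.1.1)).unique h3.hasDerivAt
  simpa using h4

/-- Along the slice with constant fibre coordinate `r ≠ 0` the lift is `r` times the coordinate of
the section, so division by `r` transfers the vanishing of the differential to the base. -/
theorem hasMFDerivAt_coord_eq_zero_of_d_lift_eq_zero (h : d (lift s) q = 0) :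
    HasMFDerivAt L.base.I 𝓘(ℝ, ℝ) (coord s q.1.1) q.1.1 (0 : L.base.E →L[ℝ] ℝ) := by
  have hx := mem_baseSet_trivializationAt ℝ L.fiber q.1.1
  have hr := dualCoord_ne_zero hx q.2
  set r := dualCoord L.fiber q.1.1 q.1
  have h0 := hasMFDerivAt_lift_eq_zero h
  rw [← slitParam_dualCoord hx] at h0
  have h1 := HasMFDerivAt.comp_eq_zero (I := L.base.I)
    (g := fun x : L.base ↦ slitParam q.1.1 (x, r)) (p := q.1.1) h0
    (ContMDiffAt.comp (g := slitParam q.1.1) (f := fun x ↦ (x, r)) q.1.1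
      (contMDiffAt_slitParam (a := (q.1.1, r)) hx hr) (contMDiffAt_id.prodMk contMDiffAt_const))
  have h2 := (h1.const_smul r⁻¹).congr_mfderiv (smul_zero r⁻¹)
  refine h2.congr_of_eventuallyEq ?_
  filter_upwards [(trivializationAt ℝ L.fiber q.1.1).open_baseSet.mem_nhds hx] with x hx
  change _ = r⁻¹ * lift s (slitParam q.1.1 (x, r))
  rw [lift_slitParam s (a := (x, r)) hx hr]
  field_simp

theorem lift_eq_zero_of_d_lift_eq_zero (h : d (lift s) q = 0) : lift s q = 0 := by
  rw [lift_eq_coord_mul s (mem_baseSet_trivializationAt ℝ L.fiber q.1.1),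
    coord_eq_zero_of_d_lift_eq_zero h, zero_mul]

/-- A derivation of a line bundle only depends on the differential of the lift of a section. -/
theorem IsDerivation.lift_eq_zero {D : L.Sections →ₗ[ℝ] L.Sections} (hD : IsDerivation D)
    (h : d (lift s) q = 0) : lift (D s) q = 0 := by
  obtain ⟨X, hX⟩ := hD
  obtain ⟨χ, s₀, h1, hχ, hs₀⟩ := exists_cutoff_frame q.1.1
  let a : L.base.Fun := ⟨fun x ↦ χ x * coord s q.1.1 x, contMDiff_of_tsupport fun x hx ↦
    χ.contMDiff.contMDiffAt.mul (contMDiffAt_coord s (hχ (tsupport_mul_subset_left hx)))⟩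
  -- This global identity replaces an appeal to locality of `D`. Applying `D` to the left side gives
  -- zero at the base point, since `a` and its differential vanish there; on the right only `χ² D s`
  -- remains, since `s` vanishes there, and `χ = 1` at that point.
  have hsec : smulSection a s₀ = smulSection (χ * χ) s := by
    ext x
    change (χ x * coord s q.1.1 x) • s₀ x = (χ x * χ x) • s x
    rw [hs₀]
    by_cases hx : x ∈ tsupport χ
    · rw [eq_coord_smul s (hχ hx), smul_smul, smul_smul]
      congr 1
      ring
    · rw [image_eq_zero_of_notMem_tsupport hx]
      simp
  have hs : s q.1.1 = 0 := section_eq_zero_of_lift_eq_zero (lift_eq_zero_of_d_lift_eq_zero h)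
  have ha : a q.1.1 = 0 := by
    change χ _ * coord s _ _ = 0
    rw [coord_eq_zero_of_d_lift_eq_zero h, mul_zero]
  have hda : X.deriv a q.1.1 = 0 := by
    have h2 : d a q.1.1 = 0 := d_eq_of_hasMFDerivAt
      ((hasMFDerivAt_coord_eq_zero_of_d_lift_eq_zero h).congr_of_eventuallyEq (by
        filter_upwards [h1] with x hx
        change χ x * coord s q.1.1 x = _
        rw [hx, one_mul]))
    exact DFunLike.congr_fun h2 (X q.1.1)
  have h2 := hX a s₀ q.1.1
  rw [hsec, hX, hs, ha, hda, smul_zero, zero_smul, zero_smul, zero_add, add_zero] at h2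
  change (χ q.1.1 * χ q.1.1) • D s q.1.1 = 0 at h2
  rw [h1.self_of_nhds, mul_one, one_smul] at h2
  rw [lift_apply, h2, map_zero]

end VanishingDifferential

theorem dMap_slitProj_eq_zero_of_coordinates {q : L.slit} {ι : Type}
    {b : Module.Basis ι ℝ L.base.E} {ξ : ι → L.base.Fun}
    (hξ : ∀ i, (ξ i : L.base → ℝ) =ᶠ[𝓝 q.1.1] fun x ↦ b.repr (chart q.1.1 x) i)
    {w : L.base.E} (h : ∀ i, d (ξ i) q.1.1 w = 0) : w = 0 := by
  have hx := mem_extChartAt_source (I := L.base.I) q.1.1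
  obtain ⟨A, hA⟩ := isInvertible_mfderiv_chart hx
  refine A.map_eq_zero_iff.1 (b.ext_elem fun i ↦ ?_)
  have h' := h i
  rw [d_coordinate hx (hξ i), ← hA] at h'
  rw [map_zero]
  exact h'

/-- The kernels of the differentials of the projection and of a fibre coordinate meet trivially. -/
theorem eq_zero_of_dMap_slitProj_eq_zero {q : L.slitDual.total} {u : L.slitDual.total.Fun}
    (hu : (u : L.slitDual.total → ℝ) =ᶠ[𝓝 q]
      fun p ↦ dualCoord L.fiber (slitProj q) (p : L.slit).1)
    {v : L.slitDual.total.E} (h1 : dMap slitProj q v = 0) (h2 : d u q v = 0) : v = 0 := by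
  have hx := mem_baseSet_trivializationAt ℝ L.fiber (slitProj q)
  have huq : u q = dualCoord L.fiber (slitProj q) (q : L.slit).1 := hu.self_of_nhds
  have hS := contMDiffAt_slitParam (a := (slitProj q, u q)) hx (by
    change u q ≠ 0
    rw [huq]; exact dualCoord_ne_zero hx (q : L.slit).2)
  have hp := ((slitProj (L := L)).contMDiff.mdifferentiable (by simp) q).hasMFDerivAt.prodMk
    (hasMFDerivAt_d u q)
  have hc := HasMFDerivAt.comp q (g := slitParam (slitProj q))
    (hS.mdifferentiableAt (by simp)).hasMFDerivAt hp
  -- Near `q` the identity factors through the pair of projection and fibre coordinate. By the chain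
  -- rule `v` is the image of the pair of its two differentials, both zero.
  have hid : (id : L.slitDual.total → L.slitDual.total) =ᶠ[𝓝 q]
      (slitParam (slitProj q) ∘ fun p : L.slitDual.total ↦ (slitProj p, u p)) := by
    filter_upwards [hu, (slitProj (L := L)).contMDiff.continuous.continuousAt.preimage_mem_nhds
      ((trivializationAt ℝ L.fiber (slitProj q)).open_baseSet.mem_nhds hx)] with p hp hpx
    change p = slitParam (slitProj q) (slitProj p, u p)
    rw [hp]
    exact (slitParam_dualCoord (q := p) hpx).symm
  have h3 := hasMFDerivAt_unique (hasMFDerivAt_id q) (hc.congr_of_eventuallyEq hid)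
  have h4 : v = mfderiv (L.base.I.prod 𝓘(ℝ, ℝ)) L.slitDual.total.I (slitParam (slitProj q))
      (slitProj q, u q) (dMap slitProj q v, d u q v) := DFunLike.congr_fun h3 v
  rw [h1, h2] at h4
  exact h4.trans (map_zero _)

theorem d_lift_smulSection (f : L.base.Fun) (s : L.Sections) (q : L.slitDual.total)
    (v : L.slitDual.total.E) : d (lift (smulSection f s)) q v =
      f (slitProj q) * d (lift s) q v + lift s q * d f (slitProj q) (dMap slitProj q v) := by
  rw [lift_smulSection, d_mul, d_pullback]
  rfl

/-- Around each point there are finitely many lifts whose differentials span. -/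
theorem exists_lift_coframe (q : L.slit) : ∃ (n : ℕ) (s : Option (Fin n) → L.Sections),
    Function.Bijective fun (v : L.slitDual.total.E) (i : Option (Fin n)) ↦ d (lift (s i)) q v := by
  have hx := mem_baseSet_trivializationAt ℝ L.fiber q.1.1
  obtain ⟨χ, s₀, h1, hχ, hs₀⟩ := exists_cutoff_frame q.1.1
  have b := Module.finBasis ℝ L.base.E
  obtain ⟨ξ, hξ⟩ := exists_coordinates b q.1.1
  have hu : (lift s₀ : L.slit → ℝ) =ᶠ[𝓝 q] fun p ↦ dualCoord L.fiber q.1.1 p.1 := by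
    filter_upwards [contMDiff_slit_proj.continuous.continuousAt.eventually h1] with p hp
    rw [lift_apply, hs₀, hp, one_smul]
    rfl
  have hu0 : lift s₀ q ≠ 0 := by
    rw [hu.self_of_nhds]
    exact dualCoord_ne_zero hx q.2
  -- The local frame and its multiples by coordinates. If `du(v) = 0` for the lift `u` of the frame,
  -- then `d(ξ_i u)(v) = u dξ_i(π_* v)`; as `u q ≠ 0`, vanishing of all of these forces `π_* v = 0`,
  -- hence `v = 0`. There are `dim M + 1` of them, the dimension of the slit dual, so injectivity
  -- suffices.
  let s : Option (Fin (Module.finrank ℝ L.base.E)) → L.Sections :=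
    fun i ↦ i.elim s₀ fun i ↦ smulSection (ξ i) s₀
  let T : L.slitDual.total.E →ₗ[ℝ] (Option (Fin (Module.finrank ℝ L.base.E)) → ℝ) :=
    LinearMap.pi fun i ↦ (d (lift (s i)) q : L.slitDual.total.E →ₗ[ℝ] ℝ)
  have hinj : Function.Injective T := by
    refine (injective_iff_map_eq_zero T).2 fun v hv ↦ ?_
    have hv0 : d (lift s₀) q v = 0 := congrFun hv none
    refine eq_zero_of_dMap_slitProj_eq_zero hu
      (dMap_slitProj_eq_zero_of_coordinates hξ fun i ↦ ?_) hv0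
    have hvi : d (lift (smulSection (ξ i) s₀)) q v = 0 := congrFun hv (some i)
    have h2 := (d_lift_smulSection (ξ i) s₀ q v).symm.trans hvi
    rw [hv0, mul_zero, zero_add] at h2
    exact (mul_eq_zero.1 h2).resolve_left hu0
  have hfin : Module.finrank ℝ L.slitDual.total.E =
      Module.finrank ℝ (Option (Fin (Module.finrank ℝ L.base.E)) → ℝ) := by
    change Module.finrank ℝ (L.base.E × (ℝ →L[ℝ] ℝ)) = _
    rw [Module.finrank_prod, Module.finrank_fintype_fun_eq_card, Fintype.card_option,
      Fintype.card_fin, ← (ContinuousLinearMap.toSpanSingletonCLE (𝕜 := ℝ)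
        (E := ℝ)).toLinearEquiv.finrank_eq, Module.finrank_self]
  exact ⟨_, s, hinj, (LinearMap.injective_iff_surjective_of_finrank_eq_finrank hfin).1 hinj⟩

theorem exists_eventually_d_eq_sum_lift (q : L.slit) : ∃ (n : ℕ) (s : Option (Fin n) → L.Sections),
    ∀ f : L.slitDual.total.Fun, ∃ c : Option (Fin n) → L.slitDual.total.Fun,
      ∀ᶠ p in 𝓝 (q : L.slitDual.total), d f p = ∑ i, c i p • d (lift (s i)) p := by
  obtain ⟨n, s, hs⟩ := exists_lift_coframe q
  exact ⟨n, s, fun f ↦ exists_eventually_d_eq_sum (fun i ↦ lift (s i)) q hs f⟩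

theorem d_lift_sum {n : ℕ} (c : Option (Fin n) → ℝ) (s : Option (Fin n) → L.Sections)
    (q : L.slitDual.total) :
    d (lift (∑ i, c i • s i)) q = ∑ i, c i • d (lift (s i)) q := by
  rw [lift_sum, d_sum]
  exact Finset.sum_congr rfl fun i _ ↦ by rw [lift_smul, d_smul]

/-- At a single point the coefficients of the coframe expansion may be frozen to constants, and a
constant combination of lifts is again a lift. -/
theorem exists_d_eq_d_lift (f : L.slitDual.total.Fun) (q : L.slitDual.total) :
    ∃ s : L.Sections, d f q = d (lift s) q := by
  obtain ⟨n, s, hs⟩ := exists_eventually_d_eq_sum_lift q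
  obtain ⟨c, hc⟩ := hs f
  exact ⟨∑ i, c i q • s i, by rw [d_lift_sum, hc.self_of_nhds]⟩

end LineBundle

/-! ### Pull-backs and the Jacobiator of a biderivation -/

namespace SmoothManifold

variable {N N' : SmoothManifold}

/-- The pull-back of functions, as a linear map. -/
def pullbackLin (Φ : N.Map N') : N'.Fun →ₗ[ℝ] N.Fun where
  toFun := pullback Φ
  map_add' _ _ := rfl
  map_smul' _ _ := rfl

theorem pullback_add (Φ : N.Map N') (f g : N'.Fun) :
    pullback Φ (f + g) = pullback Φ f + pullback Φ g := rfl

theorem pullback_mul (Φ : N.Map N') (f g : N'.Fun) :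
    pullback Φ (f * g) = pullback Φ f * pullback Φ g := rfl

theorem pullback_smul (Φ : N.Map N') (c : ℝ) (f : N'.Fun) :
    pullback Φ (c • f) = c • pullback Φ f := rfl

section Jacobiator

variable (B : N.Fun →ₗ[ℝ] N.Fun →ₗ[ℝ] N.Fun)

/-- The Jacobiator of a bilinear bracket on functions, as a linear map in the last argument. -/
def jacobiator (f g : N.Fun) : N.Fun →ₗ[ℝ] N.Fun :=
  B f ∘ₗ B g + B g ∘ₗ B.flip f + B.flip (B f g)

theorem jacobiator_apply (f g k : N.Fun) :
    jacobiator B f g k = B f (B g k) + B g (B k f) + B k (B f g) := rfl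

/-- Transfers what is proved for the last argument to the other two. -/
theorem jacobiator_cycle (f g k : N.Fun) : jacobiator B f g k = jacobiator B k f g := by
  rw [jacobiator_apply, jacobiator_apply]
  abel

variable {B}

theorem bracket_skew (hs : ∀ f, B f f = 0) (f g : N.Fun) : B f g = -B g f := by
  have h := hs (f + g)
  simp only [map_add, LinearMap.add_apply, hs, zero_add, add_zero] at h
  rw [eq_neg_iff_add_eq_zero, add_comm]
  exact h

theorem leibniz_left_of_right (hs : ∀ f, B f f = 0)
    (hl : ∀ f g k, B f (g * k) = g * B f k + k * B f g) (f g k : N.Fun) :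
    B (f * g) k = f * B g k + g * B f k := by
  rw [bracket_skew hs, hl, bracket_skew hs g, bracket_skew hs f]
  ring

/-- The terms that are products of two brackets cancel by skew-symmetry; this is why the Jacobiator
is a derivation although the iterated brackets are of second order. -/
theorem jacobiator_mul (hs : ∀ f, B f f = 0)
    (hl : ∀ f g k, B f (g * k) = g * B f k + k * B f g) (f g k l : N.Fun) :
    jacobiator B f g (k * l) = k * jacobiator B f g l + l * jacobiator B f g k := by
  simp only [jacobiator_apply]
  rw [hl g k l, map_add, hl f, hl f, leibniz_left_of_right hs hl k l f, map_add, hl g, hl g,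
    leibniz_left_of_right hs hl k l, bracket_skew hs l f, bracket_skew hs k f]
  ring

theorem isPointDerivation_jacobiator (hs : ∀ f, B f f = 0)
    (hl : ∀ f g k, B f (g * k) = g * B f k + k * B f g) (f g : N.Fun) (q : N) :
    IsPointDerivation q (evalLin q ∘ₗ jacobiator B f g) := fun k l ↦ by
  change jacobiator B f g (k * l) q = _
  rw [jacobiator_mul hs hl]
  rfl

end Jacobiator

end SmoothManifold

/-! ### Biderivations along a map, tested on lifts -/

namespace PoissonBracket

open SmoothManifold

variable {N N' : SmoothManifold}

/-- The bilinear form `(f, g) ↦ {Φ^* f, Φ^* g}(p)`. -/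
def evalPullback (b : PoissonBracket N) (Φ : N.Map N') (p : N) :
    N'.Fun →ₗ[ℝ] N'.Fun →ₗ[ℝ] ℝ :=
  (b.bracket.compl₁₂ (pullbackLin Φ) (pullbackLin Φ)).compr₂ (evalLin p)

theorem evalPullback_apply (b : PoissonBracket N) (Φ : N.Map N') (p : N) (f g : N'.Fun) :
    b.evalPullback Φ p f g = b.bracket (pullback Φ f) (pullback Φ g) p := rfl

/-- Taking for `Φ` the identity, `h_t` or `F̃` turns uniqueness, homogeneity and the Poisson
property into equalities of biderivations at one point. -/
theorem isPointDerivation_evalPullback (b : PoissonBracket N) (Φ : N.Map N') (p : N)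
    (f : N'.Fun) : IsPointDerivation (Φ p) (b.evalPullback Φ p f) := fun g k ↦ by
  rw [evalPullback_apply, pullback_mul, b.leibniz_right]
  rfl

theorem isPointDerivation_evalPullback_flip (b : PoissonBracket N) (Φ : N.Map N') (p : N)
    (k : N'.Fun) : IsPointDerivation (Φ p) ((b.evalPullback Φ p).flip k) := fun f g ↦ by
  rw [LinearMap.flip_apply, evalPullback_apply, pullback_mul, b.leibniz_left]
  rfl

end PoissonBracket

namespace LineBundle

open SmoothManifold

variable {L : LineBundle}

/-- A biderivation at a point is determined by its values on lifts of sections. -/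
theorem bilinear_eq_of_lift {q : L.slitDual.total}
    {β β' : L.slitDual.total.Fun →ₗ[ℝ] L.slitDual.total.Fun →ₗ[ℝ] ℝ}
    (h₁ : ∀ g, IsPointDerivation q (β.flip g)) (h₂ : ∀ f, IsPointDerivation q (β f))
    (h₁' : ∀ g, IsPointDerivation q (β'.flip g)) (h₂' : ∀ f, IsPointDerivation q (β' f))
    (h : ∀ s t : L.Sections, β (lift s) (lift t) = β' (lift s) (lift t))
    (f g : L.slitDual.total.Fun) : β f g = β' f g := by
  obtain ⟨s, hs⟩ := exists_d_eq_d_lift f q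
  obtain ⟨t, ht⟩ := exists_d_eq_d_lift g q
  have e1 : β f (lift t) = β (lift s) (lift t) := (h₁ (lift t)).eq_of_d_eq hs
  have e2 : β' f (lift t) = β' (lift s) (lift t) := (h₁' (lift t)).eq_of_d_eq hs
  rw [(h₂ f).eq_of_d_eq ht, (h₂' f).eq_of_d_eq ht, e1, e2, h]

theorem pullback_h_lift (t : ℝˣ) (s : L.Sections) :
    pullback (L.slitDual.h t) (lift s) = (t : ℝ) • lift s := rfl

theorem pullback_slitDualMap_lift {L₁ L₂ : LineBundle} (F : Hom L₁ L₂) (s : L₂.Sections) :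
    pullback (slitDualMap F).toMap (lift s) = lift (F.pullback s) := rfl

end LineBundle

/-! ### From Jacobi brackets to Poisson brackets -/

namespace JacobiBracket

open SmoothManifold LineBundle

variable {L : LineBundle} (J : JacobiBracket L)

/-- Well-definedness of the bracket on functions. Bilinearity leaves the terms `{s - s', t}` and
`{s', t - t'}`, each a derivation of `L` applied to a section whose lift has zero differential at
`q`. -/
theorem lift_bracket_eq {q : L.slitDual.total} {s s' t t' : L.Sections}
    (hs : d (lift s) q = d (lift s') q) (ht : d (lift t) q = d (lift t') q) :
    lift (J.bracket s t) q = lift (J.bracket s' t') q := by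
  have h1 : lift (J.bracket (s - s') t) q = 0 := (J.isDerivation_left t).lift_eq_zero
    (s := s - s') (by rw [lift_sub]; exact (d_sub _ _ q).trans (sub_eq_zero.2 hs))
  have h2 : lift (J.bracket s' (t - t')) q = 0 := (J.isDerivation_right s').lift_eq_zero
    (s := t - t') (by rw [lift_sub]; exact (d_sub _ _ q).trans (sub_eq_zero.2 ht))
  have h3 : J.bracket s t = J.bracket (s - s') t + J.bracket s' (t - t') + J.bracket s' t' := by
    rw [map_sub, map_sub, LinearMap.sub_apply]
    abel
  rw [h3, lift_add, lift_add]
  change lift (J.bracket (s - s') t) q + lift (J.bracket s' (t - t')) q +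
    lift (J.bracket s' t') q = _
  rw [h1, h2, zero_add, zero_add]

/-- The value at a point of the Poisson bracket induced by a Jacobi bracket. -/
def poissonVal (f g : L.slitDual.total.Fun) (q : L.slitDual.total) : ℝ :=
  lift (J.bracket (exists_d_eq_d_lift f q).choose (exists_d_eq_d_lift g q).choose) q

/-- Frees the definition from the chosen sections, so that sections adapted to each identity can be
used below. -/
theorem poissonVal_eq {f g : L.slitDual.total.Fun} {q : L.slitDual.total} {s t : L.Sections}
    (hs : d f q = d (lift s) q) (ht : d g q = d (lift t) q) :
    J.poissonVal f g q = lift (J.bracket s t) q :=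
  J.lift_bracket_eq ((exists_d_eq_d_lift f q).choose_spec.symm.trans hs)
    ((exists_d_eq_d_lift g q).choose_spec.symm.trans ht)

/-- Around `q` both differentials expand over the same finite family of lifts with smooth
coefficients, and the bracket becomes the corresponding double sum of the smooth functions `lift
{s_i, s_j}`. -/
theorem contMDiff_poissonVal (f g : L.slitDual.total.Fun) :
    ContMDiff L.slitDual.total.I 𝓘(ℝ, ℝ) ∞ (J.poissonVal f g) := by
  intro q
  obtain ⟨n, s, hs⟩ := exists_eventually_d_eq_sum_lift q
  obtain ⟨a, ha⟩ := hs f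
  obtain ⟨c, hc⟩ := hs g
  have h : ContMDiffAt L.slitDual.total.I 𝓘(ℝ, ℝ) ∞
      (fun p ↦ ∑ i, ∑ j, a i p * (c j p * lift (J.bracket (s i) (s j)) p)) q := by
    refine ContMDiffAt.sum fun i _ ↦ ContMDiffAt.sum fun j _ ↦ ?_
    exact (a i).contMDiff.contMDiffAt.mul
      ((c j).contMDiff.contMDiffAt.mul (lift (J.bracket (s i) (s j))).contMDiff.contMDiffAt)
  refine h.congr_of_eventuallyEq ?_
  filter_upwards [ha, hc] with p hap hcp
  rw [J.poissonVal_eq (hap.trans (d_lift_sum _ s p).symm) (hcp.trans (d_lift_sum _ s p).symm)]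
  simp only [map_sum, map_smul, LinearMap.sum_apply, LinearMap.smul_apply, Finset.smul_sum]
  change (evalLin p ∘ₗ liftLin L) _ = _
  simp only [map_sum, map_smul, smul_eq_mul]
  rw [Finset.sum_comm]
  refine Finset.sum_congr rfl fun i _ ↦ Finset.sum_congr rfl fun j _ ↦ ?_
  rw [mul_left_comm]
  rfl

theorem poissonVal_add_right (f g k : L.slitDual.total.Fun) (q : L.slitDual.total) :
    J.poissonVal f (g + k) q = J.poissonVal f g q + J.poissonVal f k q := by
  obtain ⟨s, hs⟩ := exists_d_eq_d_lift f q
  obtain ⟨t, ht⟩ := exists_d_eq_d_lift g q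
  obtain ⟨r, hr⟩ := exists_d_eq_d_lift k q
  rw [J.poissonVal_eq hs ht, J.poissonVal_eq hs hr, J.poissonVal_eq (t := t + r) hs
    (by rw [lift_add, d_add, d_add, ht, hr]), map_add, lift_add]
  rfl

theorem poissonVal_smul_right (c : ℝ) (f g : L.slitDual.total.Fun) (q : L.slitDual.total) :
    J.poissonVal f (c • g) q = c * J.poissonVal f g q := by
  obtain ⟨s, hs⟩ := exists_d_eq_d_lift f q
  obtain ⟨t, ht⟩ := exists_d_eq_d_lift g q
  rw [J.poissonVal_eq hs ht, J.poissonVal_eq (t := c • t) hs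
    (by rw [lift_smul, d_smul, d_smul, ht]), map_smul, lift_smul]
  rfl

theorem poissonVal_self (f : L.slitDual.total.Fun) (q : L.slitDual.total) :
    J.poissonVal f f q = 0 := by
  obtain ⟨s, hs⟩ := exists_d_eq_d_lift f q
  rw [J.poissonVal_eq hs hs, J.bracket_self, lift_zero]
  rfl

theorem bracket_skew (s t : L.Sections) : J.bracket s t = -J.bracket t s := by
  have h := J.bracket_self (s + t)
  simp only [map_add, LinearMap.add_apply, J.bracket_self, zero_add, add_zero] at h
  rw [eq_neg_iff_add_eq_zero, add_comm]
  exact h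

theorem poissonVal_skew (f g : L.slitDual.total.Fun) (q : L.slitDual.total) :
    J.poissonVal f g q = -J.poissonVal g f q := by
  obtain ⟨s, hs⟩ := exists_d_eq_d_lift f q
  obtain ⟨t, ht⟩ := exists_d_eq_d_lift g q
  rw [J.poissonVal_eq hs ht, J.poissonVal_eq ht hs, J.bracket_skew]
  exact DFunLike.congr_fun (map_neg (liftLin L) (J.bracket t s)) q

theorem poissonVal_mul_right (f g k : L.slitDual.total.Fun) (q : L.slitDual.total) :
    J.poissonVal f (g * k) q = g q * J.poissonVal f k q + k q * J.poissonVal f g q := by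
  obtain ⟨s, hs⟩ := exists_d_eq_d_lift f q
  obtain ⟨t, ht⟩ := exists_d_eq_d_lift g q
  obtain ⟨r, hr⟩ := exists_d_eq_d_lift k q
  -- The section representing `d(g k) = g dk + k dg` has the constants `g q` and `k q` as
  -- coefficients, so bilinearity over `ℝ` already yields the Leibniz rule at `q`.
  rw [J.poissonVal_eq hs ht, J.poissonVal_eq hs hr, J.poissonVal_eq (t := g q • r + k q • t) hs
    (by rw [lift_add, d_add, lift_smul, lift_smul, d_smul, d_smul, d_mul, ht, hr]), map_add,
    lift_add, map_smul, map_smul, lift_smul, lift_smul]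
  rfl

/-- The biderivation of functions on the slit dual induced by a Jacobi bracket. -/
def poissonBilin : L.slitDual.total.Fun →ₗ[ℝ] L.slitDual.total.Fun →ₗ[ℝ] L.slitDual.total.Fun :=
  LinearMap.mk₂ ℝ (fun f g ↦ ⟨J.poissonVal f g, J.contMDiff_poissonVal f g⟩)
    (fun f g k ↦ by
      ext q
      change J.poissonVal (f + g) k q = J.poissonVal f k q + J.poissonVal g k q
      rw [J.poissonVal_skew, J.poissonVal_add_right, J.poissonVal_skew f, J.poissonVal_skew g]
      ring)
    (fun c f g ↦ by
      ext q
      change J.poissonVal (c • f) g q = c * J.poissonVal f g q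
      rw [J.poissonVal_skew, J.poissonVal_smul_right, J.poissonVal_skew f]
      ring)
    (fun f g k ↦ by
      ext q
      exact J.poissonVal_add_right f g k q)
    (fun c f g ↦ by
      ext q
      exact J.poissonVal_smul_right c f g q)

theorem poissonBilin_self (f : L.slitDual.total.Fun) : J.poissonBilin f f = 0 := by
  ext q
  exact J.poissonVal_self f q

theorem poissonBilin_mul (f g k : L.slitDual.total.Fun) :
    J.poissonBilin f (g * k) = g * J.poissonBilin f k + k * J.poissonBilin f g := by
  ext q
  exact J.poissonVal_mul_right f g k q

theorem poissonBilin_lift (s t : L.Sections) :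
    J.poissonBilin (lift s) (lift t) = lift (J.bracket s t) := by
  ext q
  exact J.poissonVal_eq rfl rfl

theorem jacobiator_lift (s t r : L.Sections) :
    jacobiator J.poissonBilin (lift s) (lift t) (lift r) = 0 := by
  rw [jacobiator_apply]
  simp only [poissonBilin_lift]
  rw [← lift_add, ← lift_add, J.jacobi, lift_zero]

/-- At a point each argument may be exchanged for a lift with the same differential, one slot at a
time by cyclic symmetry; on lifts the Jacobi identity is that of `J`. -/
theorem jacobiator_eq_zero (f g k : L.slitDual.total.Fun) :
    jacobiator J.poissonBilin f g k = 0 := by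
  ext q
  obtain ⟨s, hs⟩ := exists_d_eq_d_lift f q
  obtain ⟨t, ht⟩ := exists_d_eq_d_lift g q
  obtain ⟨r, hr⟩ := exists_d_eq_d_lift k q
  have hD : ∀ f g {k k' : L.slitDual.total.Fun}, d k q = d k' q →
      jacobiator J.poissonBilin f g k q = jacobiator J.poissonBilin f g k' q := fun f g _ _ h ↦
    (isPointDerivation_jacobiator J.poissonBilin_self J.poissonBilin_mul f g q).eq_of_d_eq h
  rw [hD f g hr, jacobiator_cycle, hD _ _ ht, jacobiator_cycle, hD _ _ hs, jacobiator_cycle,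
    jacobiator_lift]

/-- The Poisson bracket on the slit dual induced by a Jacobi bracket. -/
def poissonization : PoissonBracket L.slitDual.total where
  bracket := J.poissonBilin
  bracket_self := J.poissonBilin_self
  jacobi := J.jacobiator_eq_zero
  leibniz_left := leibniz_left_of_right J.poissonBilin_self J.poissonBilin_mul
  leibniz_right := J.poissonBilin_mul

theorem isPoissonization_poissonization : IsPoissonization J J.poissonization :=
  J.poissonBilin_lift

end JacobiBracket

/-! ### Uniqueness, homogeneity and functoriality -/

namespace IsPoissonization

open SmoothManifold LineBundle

theorem unique {L : LineBundle} {J : JacobiBracket L} {b b' : PoissonBracket L.slitDual.total}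
    (h : IsPoissonization J b) (h' : IsPoissonization J b') : b = b' := by
  refine PoissonBracket.ext (LinearMap.ext fun f ↦ LinearMap.ext fun g ↦ ?_)
  ext q
  refine bilinear_eq_of_lift (b.isPointDerivation_evalPullback_flip ContMDiffMap.id q)
    (b.isPointDerivation_evalPullback ContMDiffMap.id q)
    (b'.isPointDerivation_evalPullback_flip ContMDiffMap.id q)
    (b'.isPointDerivation_evalPullback ContMDiffMap.id q) (fun s t ↦ ?_) f g
  exact DFunLike.congr_fun ((h s t).trans (h' s t).symm) q

/-- Both sides are biderivations at `h_t q`, so lifts suffice. There each argument contributes a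
factor `t` to the right side, which with `t⁻¹` leaves `t`, the degree of the lift on the left. -/
theorem isHomogeneous {L : LineBundle} {J : JacobiBracket L} {b : PoissonBracket L.slitDual.total}
    (h : IsPoissonization J b) : b.IsHomogeneous := by
  intro t f g
  ext q
  have hD := fun f : L.slitDual.total.Fun ↦ b.isPointDerivation_evalPullback (L.slitDual.h t) q f
  have hD' := fun f : L.slitDual.total.Fun ↦
    b.isPointDerivation_evalPullback_flip (L.slitDual.h t) q f
  refine bilinear_eq_of_lift (q := L.slitDual.h t q) (β := b.evalPullback ContMDiffMap.id _)
    (β' := (t : ℝ)⁻¹ • b.evalPullback (L.slitDual.h t) q)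
    (b.isPointDerivation_evalPullback_flip ContMDiffMap.id _)
    (b.isPointDerivation_evalPullback ContMDiffMap.id _) (fun k f g ↦ ?_) (fun k f g ↦ ?_)
    (fun s r ↦ ?_) f g
  · have := hD' k f g
    simp only [LinearMap.flip_apply, LinearMap.smul_apply, smul_eq_mul] at this ⊢
    rw [this]
    ring
  · have := hD k f g
    simp only [LinearMap.smul_apply, smul_eq_mul] at this ⊢
    rw [this]
    ring
  · simp only [LinearMap.smul_apply, PoissonBracket.evalPullback_apply, pullback_h_lift, map_smul]
    change b.bracket (lift s) (lift r) (L.slitDual.h t q) =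
      (t : ℝ)⁻¹ * ((t : ℝ) * ((t : ℝ) * b.bracket (lift s) (lift r) q))
    rw [inv_mul_cancel_left₀ t.ne_zero, h]
    rfl

/-- Both sides are biderivations at `F̃ q`, and on lifts the claim is the Jacobi condition, since
`F̃^* λ̃` is the lift of `F^* λ`. -/
theorem isPoissonMap {L₁ L₂ : LineBundle} {J₁ : JacobiBracket L₁} {J₂ : JacobiBracket L₂}
    {b₁ : PoissonBracket L₁.slitDual.total} {b₂ : PoissonBracket L₂.slitDual.total}
    (h₁ : IsPoissonization J₁ b₁) (h₂ : IsPoissonization J₂ b₂) {F : LineBundle.Hom L₁ L₂}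
    (hF : F.IsJacobi J₁ J₂) : IsPoissonMap (slitDualMap F).toMap b₁ b₂ := by
  intro f g
  ext q
  refine bilinear_eq_of_lift (q := (slitDualMap F).toMap q)
    (b₁.isPointDerivation_evalPullback_flip (slitDualMap F).toMap q)
    (b₁.isPointDerivation_evalPullback (slitDualMap F).toMap q)
    (b₂.isPointDerivation_evalPullback_flip ContMDiffMap.id _)
    (b₂.isPointDerivation_evalPullback ContMDiffMap.id _) (fun s t ↦ ?_) f g
  rw [PoissonBracket.evalPullback_apply, pullback_slitDualMap_lift, pullback_slitDualMap_lift,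
    h₁, hF, ← pullback_slitDualMap_lift, ← h₂]
  rfl

theorem isJacobi {L₁ L₂ : LineBundle} {J₁ : JacobiBracket L₁} {J₂ : JacobiBracket L₂}
    {b₁ : PoissonBracket L₁.slitDual.total} {b₂ : PoissonBracket L₂.slitDual.total}
    (h₁ : IsPoissonization J₁ b₁) (h₂ : IsPoissonization J₂ b₂) {F : LineBundle.Hom L₁ L₂}
    (hF : IsPoissonMap (slitDualMap F).toMap b₁ b₂) : F.IsJacobi J₁ J₂ := by
  intro s t
  apply lift_injective
  rw [← h₁, ← pullback_slitDualMap_lift, ← pullback_slitDualMap_lift, hF, h₂]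
  rfl

theorem unique_jacobi {L : LineBundle} {J J' : JacobiBracket L}
    {b : PoissonBracket L.slitDual.total}
    (h : IsPoissonization J b) (h' : IsPoissonization J' b) : J = J' := by
  refine JacobiBracket.ext (LinearMap.ext fun s ↦ LinearMap.ext fun t ↦ ?_)
  exact lift_injective ((h s t).symm.trans (h' s t))

end IsPoissonization

/-! ### Functions of degree one and zero; from Poisson brackets to Jacobi brackets -/

namespace LineBundle

open SmoothManifold

variable {L : LineBundle}

theorem eq_smul_slitSymm {x₀ : L.base} {q : L.slit}
    (hq : q.1.1 ∈ (trivializationAt ℝ L.fiber x₀).baseSet) :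
    q = slitFiberCoord x₀ q • slitSymm x₀ (q.1.1, 1) := by
  refine slit_ext hq rfl ?_
  rw [dualCoord_smul, dualCoord_slitSymm hq, slitFiberCoord_val hq, Units.val_one, mul_one]

/-- The covector of fibre coordinate `1` in a local trivialization. -/
def slitUnit (x₀ x : L.base) : L.slitDual.total := slitSymm x₀ (x, 1)

theorem contMDiffAt_slitUnit {x₀ x : L.base}
    (hx : x ∈ (trivializationAt ℝ L.fiber x₀).baseSet) :
    ContMDiffAt L.base.I L.slitDual.total.I ∞ (slitUnit x₀) x := by
  have h : ContMDiffAt L.base.I (L.base.I.prod 𝓘(ℝ, ℝ →L[ℝ] ℝ)) ∞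
      (fun x ↦ slitSymm x₀ (x, 1)) x :=
    ContMDiffAt.comp (g := slitSymm x₀) (f := fun x ↦ (x, 1)) x
      (contMDiffAt_slitSymm (a := (x, 1)) hx) (contMDiffAt_id.prodMk contMDiffAt_const)
  exact h

/-- Functions of degree `1` on the slit dual are lifts of sections. -/
theorem exists_lift_eq (f : L.slitDual.total.Fun)
    (hf : ∀ t : ℝˣ, pullback (L.slitDual.h t) f = (t : ℝ) • f) : ∃ s : L.Sections, lift s = f := by
  have hf' : ∀ (t : ℝˣ) (q : L.slit), f (t • q : L.slit) = t * f q := fun t q ↦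
    DFunLike.congr_fun (hf t) q
  -- The value of the section is forced by the value of `f` on the reference covector at `x`;
  -- homogeneity extends the agreement to the whole fibre. The reference covector varies with the
  -- preferred trivialization, so smoothness is checked below with the unit covectors of one fixed
  -- trivialization.
  let s : ∀ x : L.base, L.fiber x := fun x ↦ f (slitPoint x) • lineFrame L.fiber x x
  have hs : ∀ q : L.slit, (q.1.2 (s q.1.1) : ℝ) = f q := fun q ↦ by
    have hq := mem_baseSet_trivializationAt ℝ L.fiber q.1.1
    have h1 := hf' (slitFiberCoord q.1.1 q) (slitSymm q.1.1 (q.1.1, 1))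
    rw [← eq_smul_slitSymm hq, slitFiberCoord_val hq] at h1
    rw [h1, map_smul, smul_eq_mul, mul_comm]
    rfl
  refine ⟨⟨s, fun x₀ ↦ ?_⟩, ContMDiffMap.ext hs⟩
  have hx₀ := mem_baseSet_trivializationAt ℝ L.fiber x₀
  refine (contMDiffAt_line_iff (f := fun x ↦ (⟨x, s x⟩ : TotalSpace ℝ L.fiber)) (x₀ := x₀) hx₀).2
    ⟨contMDiffAt_id, ?_⟩
  refine (ContMDiffAt.comp (g := f) (f := slitUnit x₀) x₀
    f.contMDiff.contMDiffAt (contMDiffAt_slitUnit hx₀)).congr_of_eventuallyEq ?_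
  filter_upwards [(trivializationAt ℝ L.fiber x₀).open_baseSet.mem_nhds hx₀] with x hx
  have h1 := (covector_apply (q := slitSymm x₀ (x, 1)) hx (s x)).symm.trans
    (hs (slitSymm x₀ (x, 1)))
  rw [dualCoord_slitSymm (a := (x, 1)) hx, Units.val_one, mul_one] at h1
  exact h1

/-- Functions of degree `0` on the slit dual are pulled back from the base. -/
theorem exists_pullback_slitProj_eq (f : L.slitDual.total.Fun)
    (hf : ∀ t : ℝˣ, pullback (L.slitDual.h t) f = f) :
    ∃ g : L.base.Fun, pullback slitProj g = f := by
  have hf' : ∀ (t : ℝˣ) (q : L.slit), f (t • q : L.slit) = f q := fun t q ↦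
    DFunLike.congr_fun (hf t) q
  have hg : ∀ (x₀ : L.base) (q : L.slit), q.1.1 ∈ (trivializationAt ℝ L.fiber x₀).baseSet →
      f (slitSymm x₀ (q.1.1, 1) : L.slit) = f q := fun x₀ q hq ↦ by
    conv_rhs => rw [eq_smul_slitSymm hq, hf']
  refine ⟨⟨fun x ↦ f (slitPoint x), fun x₀ ↦ ?_⟩, ContMDiffMap.ext fun q ↦
    hg _ (q : L.slit) (mem_baseSet_trivializationAt ℝ L.fiber _)⟩
  have hx₀ := mem_baseSet_trivializationAt ℝ L.fiber x₀
  refine (ContMDiffAt.comp (g := f) (f := slitUnit x₀) x₀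
    f.contMDiff.contMDiffAt (contMDiffAt_slitUnit hx₀)).congr_of_eventuallyEq ?_
  filter_upwards [(trivializationAt ℝ L.fiber x₀).open_baseSet.mem_nhds hx₀] with x hx
  exact (hg x₀ (slitPoint x) hx).symm

theorem pullback_slitProj_injective :
    Function.Injective (pullback (slitProj (L := L))) := fun _ _ h ↦
  ContMDiffMap.ext fun x ↦ DFunLike.congr_fun h (slitPoint x)

end LineBundle

namespace PoissonBracket

open SmoothManifold LineBundle

variable {L : LineBundle} {b : PoissonBracket L.slitDual.total}

namespace IsHomogeneous

/-- Degree count: `1 + 1 - 1 = 1`, and `1 + 0 - 1 = 0` when one argument is pulled back from the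
base. -/
theorem pullback_bracket_lift (hb : b.IsHomogeneous) (t : ℝˣ) (s r : L.Sections) :
    pullback (L.slitDual.h t) (b.bracket (lift s) (lift r)) =
      (t : ℝ) • b.bracket (lift s) (lift r) := by
  rw [hb, pullback_h_lift, pullback_h_lift, map_smul, map_smul, LinearMap.smul_apply,
    inv_smul_smul₀ t.ne_zero]

theorem pullback_bracket_lift_slitProj (hb : b.IsHomogeneous) (t : ℝˣ) (s : L.Sections)
    (f : L.base.Fun) :
    pullback (L.slitDual.h t) (b.bracket (lift s) (pullback slitProj f)) =
      b.bracket (lift s) (pullback slitProj f) := by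
  rw [hb, pullback_h_lift, map_smul, LinearMap.smul_apply, inv_smul_smul₀ t.ne_zero]
  rfl

theorem exists_bracket_lift (hb : b.IsHomogeneous) (s r : L.Sections) :
    ∃ k : L.Sections, lift k = b.bracket (lift s) (lift r) :=
  exists_lift_eq _ fun t ↦ hb.pullback_bracket_lift t s r

theorem exists_bracket_slitProj (hb : b.IsHomogeneous) (s : L.Sections) (f : L.base.Fun) :
    ∃ g : L.base.Fun, pullback slitProj g = b.bracket (lift s) (pullback slitProj f) :=
  exists_pullback_slitProj_eq _ fun t ↦ hb.pullback_bracket_lift_slitProj t s f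

/-- The bracket of two sections determined by a homogeneous Poisson bracket. -/
def sectionVal (hb : b.IsHomogeneous) (s r : L.Sections) : L.Sections :=
  (hb.exists_bracket_lift s r).choose

theorem lift_sectionVal (hb : b.IsHomogeneous) (s r : L.Sections) :
    lift (hb.sectionVal s r) = b.bracket (lift s) (lift r) :=
  (hb.exists_bracket_lift s r).choose_spec

/-- The bracket of sections determined by a homogeneous Poisson bracket. -/
def sectionBracket (hb : b.IsHomogeneous) : L.Sections →ₗ[ℝ] L.Sections →ₗ[ℝ] L.Sections :=
  LinearMap.mk₂ ℝ hb.sectionVal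
    (fun s s' r ↦ lift_injective (by
      simp only [lift_add, lift_sectionVal, map_add, LinearMap.add_apply]))
    (fun c s r ↦ lift_injective (by
      simp only [lift_smul, lift_sectionVal, map_smul, LinearMap.smul_apply]))
    (fun s r r' ↦ lift_injective (by
      simp only [lift_add, lift_sectionVal, map_add]))
    (fun c s r ↦ lift_injective (by
      simp only [lift_smul, lift_sectionVal, map_smul]))

theorem lift_sectionBracket (hb : b.IsHomogeneous) (s r : L.Sections) :
    lift (hb.sectionBracket s r) = b.bracket (lift s) (lift r) :=
  hb.lift_sectionVal s r

theorem sectionBracket_self (hb : b.IsHomogeneous) (s : L.Sections) :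
    hb.sectionBracket s s = 0 :=
  lift_injective (by rw [lift_sectionBracket, b.bracket_self, lift_zero])

theorem sectionBracket_skew (hb : b.IsHomogeneous) (s r : L.Sections) :
    hb.sectionBracket s r = -hb.sectionBracket r s := by
  have h := hb.sectionBracket_self (s + r)
  simp only [map_add, LinearMap.add_apply, hb.sectionBracket_self, zero_add, add_zero] at h
  rw [eq_neg_iff_add_eq_zero, add_comm]
  exact h

/-- The symbol of the derivation `{s, -}` of sections, as a derivation of functions. -/
def symbol (hb : b.IsHomogeneous) (s : L.Sections) : L.base.Fun →ₗ[ℝ] L.base.Fun where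
  toFun f := (hb.exists_bracket_slitProj s f).choose
  map_add' f g := pullback_slitProj_injective (by
    have h1 := (hb.exists_bracket_slitProj s f).choose_spec
    have h2 := (hb.exists_bracket_slitProj s g).choose_spec
    rw [(hb.exists_bracket_slitProj _ _).choose_spec]
    change b.bracket (lift s) (pullback slitProj f + pullback slitProj g) =
      pullback slitProj _ + pullback slitProj _
    rw [h1, h2, map_add])
  map_smul' c f := pullback_slitProj_injective (by
    have h1 := (hb.exists_bracket_slitProj s f).choose_spec
    rw [(hb.exists_bracket_slitProj _ _).choose_spec]
    change b.bracket (lift s) (c • pullback slitProj f) = c • pullback slitProj _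
    rw [h1, map_smul])

theorem pullback_symbol (hb : b.IsHomogeneous) (s : L.Sections) (f : L.base.Fun) :
    pullback slitProj (hb.symbol s f) = b.bracket (lift s) (pullback slitProj f) :=
  (hb.exists_bracket_slitProj s f).choose_spec

/-- The lift of `f e` is the product of the pull-back of `f` with the lift of `e`. The Leibniz rule
then separates the term `{s, f}`, of degree zero and hence a derivation of functions on the base,
from `f {s, e}`. -/
theorem isDerivation_sectionBracket (hb : b.IsHomogeneous) (s : L.Sections) :
    IsDerivation (hb.sectionBracket s) := by
  obtain ⟨X, hX⟩ := exists_vectorField (hb.symbol s) fun f g ↦ pullback_slitProj_injective (by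
    change _ = pullback slitProj f * pullback slitProj (hb.symbol s g) +
      pullback slitProj g * pullback slitProj (hb.symbol s f)
    rw [pullback_symbol, pullback_symbol, pullback_symbol, ← b.leibniz_right]
    rfl)
  refine ⟨X, fun f e x ↦ ?_⟩
  rw [← hX]
  have h : hb.sectionBracket s (smulSection f e) =
      smulSection (hb.symbol s f) e + smulSection f (hb.sectionBracket s e) :=
    lift_injective (by
      rw [lift_add, lift_sectionBracket, lift_smulSection, lift_smulSection, lift_smulSection,
        b.leibniz_right, pullback_symbol, lift_sectionBracket]
      ring)
  rw [h]
  rfl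

theorem isDerivation_sectionBracket_flip (hb : b.IsHomogeneous) (s : L.Sections) :
    IsDerivation (hb.sectionBracket.flip s) := by
  obtain ⟨X, hX⟩ := hb.isDerivation_sectionBracket s
  refine ⟨-X, fun f e x ↦ ?_⟩
  rw [LinearMap.flip_apply, LinearMap.flip_apply, hb.sectionBracket_skew _ s,
    hb.sectionBracket_skew _ s]
  have h1 : (-X : L.base.VectorField).deriv f x = -X.deriv f x :=
    map_neg (d f x) (X x)
  change -(hb.sectionBracket s (smulSection f e) x) = _ + f x • -(hb.sectionBracket s e x)
  rw [hX, h1, neg_smul, smul_neg, neg_add]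

/-- The Jacobi bracket determined by a homogeneous Poisson bracket on the slit dual. -/
def jacobiBracket (hb : b.IsHomogeneous) : JacobiBracket L where
  bracket := hb.sectionBracket
  bracket_self := hb.sectionBracket_self
  jacobi s₁ s₂ s₃ := lift_injective (by
    simp only [lift_add, lift_sectionBracket, lift_zero]
    exact b.jacobi _ _ _)
  isDerivation_left := hb.isDerivation_sectionBracket_flip
  isDerivation_right := hb.isDerivation_sectionBracket

theorem isPoissonization_jacobiBracket (hb : b.IsHomogeneous) :
    IsPoissonization hb.jacobiBracket b := fun s r ↦ (hb.lift_sectionBracket s r).symm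

end IsHomogeneous

end PoissonBracket

/-- The bijection between Jacobi brackets and homogeneous Poisson brackets on the slit dual. -/
def poissonizationEquiv (L : LineBundle) :
    JacobiBracket L ≃ {b : PoissonBracket L.slitDual.total // b.IsHomogeneous} where
  toFun J := ⟨J.poissonization, J.isPoissonization_poissonization.isHomogeneous⟩
  invFun b := b.2.jacobiBracket
  left_inv J := IsPoissonization.unique_jacobi
    (PoissonBracket.IsHomogeneous.isPoissonization_jacobiBracket _)
    J.isPoissonization_poissonization
  right_inv b := Subtype.ext (IsPoissonization.unique
    (JacobiBracket.isPoissonization_poissonization _) b.2.isPoissonization_jacobiBracket)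

/-! ### Equivariant maps of slit duals come from line bundle maps -/

namespace LineBundle

open SmoothManifold

variable {L₁ L₂ : LineBundle}

/-- Each fibre is a single orbit, so equivariant maps are determined by their values on reference
covectors. -/
theorem exists_smul_slitPoint (L : LineBundle) (q : L.slit) :
    ∃ t : ℝˣ, q = t • slitPoint q.1.1 :=
  ⟨_, eq_smul_slitSymm (mem_baseSet_trivializationAt ℝ L.fiber q.1.1)⟩

section OfEquivariant

variable (Ψ : HomogeneousManifold.Hom L₁.slitDual L₂.slitDual)

/-- An equivariant map of slit duals, as a map between the underlying types. -/
def slitFun (q : L₁.slit) : L₂.slit := Ψ.toMap q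

theorem slitFun_smul (t : ℝˣ) (q : L₁.slit) : slitFun Ψ (t • q) = t • slitFun Ψ q :=
  Ψ.map_smul t q

/-- The map of bases underlying an equivariant map of slit duals. -/
def baseFun (x : L₁.base) : L₂.base := (slitFun Ψ (slitPoint x)).1.1

theorem proj_slitFun (q : L₁.slit) : (slitFun Ψ q).1.1 = baseFun Ψ q.1.1 := by
  obtain ⟨t, ht⟩ := exists_smul_slitPoint L₁ q
  conv_lhs => rw [ht, slitFun_smul]
  rfl

theorem contMDiff_baseFun : ContMDiff L₁.base.I L₂.base.I ∞ (baseFun Ψ) := by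
  intro x₀
  have hx₀ := mem_baseSet_trivializationAt ℝ L₁.fiber x₀
  have h1 : ContMDiffAt L₁.base.I L₁.slitDual.total.I ∞ (slitUnit x₀) x₀ :=
    contMDiffAt_slitUnit hx₀
  refine (((slitProj (L := L₂)).contMDiff.comp Ψ.toMap.contMDiff).contMDiffAt.comp x₀
    h1).congr_of_eventuallyEq (Filter.Eventually.of_forall fun x ↦ ?_)
  exact (proj_slitFun Ψ (slitUnit x₀ x)).symm

/-- The fibre isomorphisms determined by an equivariant map of slit duals. -/
def fiberEquiv (x : L₁.base) : L₁.fiber x ≃L[ℝ] L₂.fiber (baseFun Ψ x) :=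
  -- With `ε` the reference covector, this is the only choice of `F_x` with `Ψ(ε) ∘ F_x = ε`.
  (covectorEquiv (slitPoint x)).trans (covectorEquiv (slitFun Ψ (slitPoint x))).symm

theorem slitFun_slitPoint_fiberEquiv (x : L₁.base) (v : L₁.fiber x) :
    ((slitFun Ψ (slitPoint x)).1.2 (fiberEquiv Ψ x v) : ℝ) = (slitPoint x).1.2 v := by
  refine (covectorEquiv_apply (slitFun Ψ (slitPoint x)) (fiberEquiv Ψ x v)).symm.trans ?_
  exact ((covectorEquiv (slitFun Ψ (slitPoint x))).apply_symm_apply _).trans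
    (covectorEquiv_apply (slitPoint x) v)

theorem triv_fiberEquiv_mul {y₀ : L₂.base} {x : L₁.base}
    (hy : baseFun Ψ x ∈ (trivializationAt ℝ L₂.fiber y₀).baseSet) (t : ℝˣ) (v : L₁.fiber x) :
    (trivializationAt ℝ L₂.fiber y₀ ⟨baseFun Ψ x, fiberEquiv Ψ x v⟩).2 *
      dualCoord L₂.fiber y₀ (slitFun Ψ (t • slitPoint x)).1 = t * ((slitPoint x).1.2 v : ℝ) := by
  rw [slitFun_smul, dualCoord_smul, mul_left_comm, ← slitFun_slitPoint_fiberEquiv]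
  exact congrArg _ (covector_apply (q := slitFun Ψ (slitPoint x)) hy (fiberEquiv Ψ x v)).symm

/-- Reference covectors depend on a trivialization that changes with `x`; rescaling to the unit
covectors of the trivialization at `x₀` expresses the fibre maps through a smooth nonzero
denominator. -/
theorem triv_fiberEquiv {x₀ x : L₁.base} {y₀ : L₂.base}
    (hx : x ∈ (trivializationAt ℝ L₁.fiber x₀).baseSet)
    (hy : baseFun Ψ x ∈ (trivializationAt ℝ L₂.fiber y₀).baseSet) (v : L₁.fiber x) :
    (trivializationAt ℝ L₂.fiber y₀ ⟨baseFun Ψ x, fiberEquiv Ψ x v⟩).2 =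
      (trivializationAt ℝ L₁.fiber x₀ ⟨x, v⟩).2 *
        (dualCoord L₂.fiber y₀ (slitFun Ψ (slitUnit x₀ x)).1)⁻¹ := by
  obtain ⟨t, ht⟩ := exists_smul_slitPoint L₁ (slitUnit x₀ x)
  have h1 := triv_fiberEquiv_mul Ψ hy t v
  have h2 : (t • slitPoint x : L₁.slit) = slitUnit x₀ x := ht.symm
  have h3 : ((t • slitPoint x : L₁.slit).1.2 v : ℝ) =
      (trivializationAt ℝ L₁.fiber x₀ ⟨x, v⟩).2 *
        dualCoord L₁.fiber x₀ (t • slitPoint x : L₁.slit).1 :=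
    covector_apply (q := t • slitPoint x) hx v
  have h4 : dualCoord L₁.fiber x₀ (t • slitPoint x : L₁.slit).1 = 1 := by
    rw [h2]
    exact dualCoord_slitSymm (a := (x, 1)) hx
  rw [h4, mul_one] at h3
  have h5 : (t : ℝ) * ((slitPoint x).1.2 v : ℝ) = (trivializationAt ℝ L₁.fiber x₀ ⟨x, v⟩).2 := h3
  rw [h2, h5] at h1
  exact (eq_mul_inv_iff_mul_eq₀ (dualCoord_ne_zero
    (Set.mem_of_eq_of_mem (proj_slitFun Ψ (slitUnit x₀ x)) hy)
    (slitFun Ψ (slitUnit x₀ x)).2)).2 h1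

/-- The line bundle map determined by an equivariant map of slit duals. -/
def Hom.ofSlitDual : Hom L₁ L₂ where
  base := ⟨baseFun Ψ, contMDiff_baseFun Ψ⟩
  fiber := fiberEquiv Ψ
  contMDiff_total := by
    intro v₀
    have hx₀ := mem_baseSet_trivializationAt ℝ L₁.fiber v₀.1
    have hy₀ := mem_baseSet_trivializationAt ℝ L₂.fiber (baseFun Ψ v₀.1)
    have hπ : ContMDiffAt (L₁.base.I.prod 𝓘(ℝ, ℝ)) L₁.base.I ∞
        (fun v : TotalSpace ℝ L₁.fiber ↦ v.1) v₀ :=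
      (Bundle.contMDiff_proj L₁.fiber).contMDiffAt
    refine (contMDiffAt_line_iff (x₀ := baseFun Ψ v₀.1) hy₀).2
      ⟨(contMDiff_baseFun Ψ).contMDiffAt.comp v₀ hπ, ?_⟩
    have h1 := ((contMDiffAt_line_iff (I := L₁.base.I) (x₀ := v₀.1)
      (f := fun v : TotalSpace ℝ L₁.fiber ↦ v) hx₀).1 contMDiffAt_id).2
    have h2 : ContMDiffAt L₁.base.I L₂.slitDual.total.I ∞
        (fun x ↦ Ψ.toMap (slitUnit v₀.1 x)) v₀.1 :=
      Ψ.toMap.contMDiff.contMDiffAt.comp v₀.1 (contMDiffAt_slitUnit hx₀)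
    have hy₁ : (slitFun Ψ (slitUnit v₀.1 v₀.1)).1.1 ∈
        (trivializationAt ℝ L₂.fiber (baseFun Ψ v₀.1)).baseSet :=
      Set.mem_of_eq_of_mem (proj_slitFun Ψ (slitUnit v₀.1 v₀.1)) hy₀
    have h3 : ContMDiffAt L₁.base.I 𝓘(ℝ, ℝ) ∞ (fun x ↦ dualCoord L₂.fiber (baseFun Ψ v₀.1)
        (slitFun Ψ (slitUnit v₀.1 x)).1) v₀.1 :=
      ((contMDiffAt_slit_iff (f := fun x ↦ slitFun Ψ (slitUnit v₀.1 x)) hy₁).1 h2).2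
    refine (h1.mul ((h3.inv₀ (dualCoord_ne_zero hy₁
      (slitFun Ψ (slitUnit v₀.1 v₀.1)).2)).comp v₀ hπ)).congr_of_eventuallyEq ?_
    filter_upwards [hπ.continuousAt.preimage_mem_nhds
        ((trivializationAt ℝ L₁.fiber v₀.1).open_baseSet.mem_nhds hx₀),
      ((contMDiff_baseFun Ψ).contMDiffAt.comp v₀ hπ).continuousAt.preimage_mem_nhds
        ((trivializationAt ℝ L₂.fiber (baseFun Ψ v₀.1)).open_baseSet.mem_nhds hy₀)] with v hx hy
    exact triv_fiberEquiv Ψ hx hy v.2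

theorem slitDualMap_ofSlitDual : slitDualMap (Hom.ofSlitDual Ψ) = Ψ := by
  refine HomogeneousManifold.Hom.ext (ContMDiffMap.ext fun q ↦ ?_)
  change slitMapFun (Hom.ofSlitDual Ψ) q = slitFun Ψ q
  have h : ∀ x : L₁.base, slitMapFun (Hom.ofSlitDual Ψ) (slitPoint x) =
      slitFun Ψ (slitPoint x) := fun x ↦ by
    refine Subtype.ext ?_
    change (⟨baseFun Ψ x, _⟩ : DualTotal L₂.fiber) = ⟨baseFun Ψ x, (slitFun Ψ (slitPoint x)).1.2⟩
    congr 1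
    refine ContinuousLinearMap.ext fun w ↦ ?_
    change ((slitPoint x).1.2 ((fiberEquiv Ψ x).symm w) : ℝ) = _
    refine (slitFun_slitPoint_fiberEquiv Ψ x ((fiberEquiv Ψ x).symm w)).symm.trans ?_
    exact congrArg (slitFun Ψ (slitPoint x)).1.2 ((fiberEquiv Ψ x).apply_symm_apply w)
  obtain ⟨t, ht⟩ := exists_smul_slitPoint L₁ q
  have h1 : slitMapFun (Hom.ofSlitDual Ψ) (t • slitPoint (q : L₁.slit).1.1) =
      t • slitMapFun (Hom.ofSlitDual Ψ) (slitPoint (q : L₁.slit).1.1) := rfl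
  rw [ht, slitFun_smul, h1, h]

end OfEquivariant

/-- From `ε ∘ F_x⁻¹ = ε ∘ G_x⁻¹` the nonzero covector `ε` can be cancelled, being an isomorphism of
the line with `ℝ`. -/
theorem slitDualMap_injective : Function.Injective (slitDualMap (L₁ := L₁) (L₂ := L₂)) := by
  rintro ⟨φ, F, hF⟩ ⟨φ', G, hG⟩ h
  have hq : ∀ q : L₁.slit, slitMapFun ⟨φ, F, hF⟩ q = slitMapFun ⟨φ', G, hG⟩ q := fun q ↦
    DFunLike.congr_fun (congrArg HomogeneousManifold.Hom.toMap h) q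
  obtain rfl : φ = φ' := ContMDiffMap.ext fun x ↦
    congrArg (fun q : L₂.slit ↦ q.1.1) (hq (slitPoint x))
  obtain rfl : F = G := by
    funext x
    have h1 := congrArg (fun q : L₂.slit ↦ q.1) (hq (slitPoint x))
    have h2 := eq_of_heq (TotalSpace.mk.inj h1).2
    have h3 : (F x).symm = (G x).symm := by
      ext w
      refine (covectorEquiv (slitPoint x)).injective ?_
      exact (covectorEquiv_apply (slitPoint x) _).trans ((DFunLike.congr_fun h2 w).trans
        (covectorEquiv_apply (slitPoint x) _).symm)
    rw [← (F x).symm_symm, h3, (G x).symm_symm]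
  rfl

end LineBundle

/-! ### Every homogeneous manifold is a slit dual -/

namespace HomogeneousManifold

open SmoothManifold LineBundle

variable (P : HomogeneousManifold)

/-- A smooth equivariant local trivialization around a point of the base. -/
def triv (x : P.base) : Trivialization ℝˣ P.proj := (P.exists_trivialization x).choose

theorem mem_triv (x : P.base) : x ∈ (P.triv x).baseSet := (P.exists_trivialization x).choose_spec.1

theorem contMDiffOn_triv (x : P.base) :
    ContMDiffOn P.total.I (P.base.I.prod 𝓘(ℝ, ℝ)) ∞ (P.triv x) (P.triv x).source :=
  (P.exists_trivialization x).choose_spec.2.1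

theorem contMDiffOn_triv_symm (x : P.base) :
    ContMDiffOn (P.base.I.prod 𝓘(ℝ, ℝ)) P.total.I ∞ (P.triv x).toOpenPartialHomeomorph.symm
      (P.triv x).target :=
  (P.exists_trivialization x).choose_spec.2.2.1

/-- The fibre coordinate of a point in a local trivialization. -/
def fiberCoord (x₀ : P.base) (p : P.total) : ℝˣ := (P.triv x₀ p).2

/-- The point with given fibre coordinate in a local trivialization. -/
def localPoint (x₀ : P.base) (a : P.base × ℝˣ) : P.total :=
  (P.triv x₀).toOpenPartialHomeomorph.symm a

variable {P}

theorem fiberCoord_smul {x₀ : P.base} (t : ℝˣ) {p : P.total}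
    (hp : P.proj p ∈ (P.triv x₀).baseSet) :
    P.fiberCoord x₀ (t • p) = t * P.fiberCoord x₀ p :=
  congrArg Prod.snd ((P.exists_trivialization x₀).choose_spec.2.2.2 t p
    ((P.triv x₀).mem_source.2 hp))

theorem proj_localPoint {x₀ : P.base} {a : P.base × ℝˣ} (ha : a.1 ∈ (P.triv x₀).baseSet) :
    P.proj (P.localPoint x₀ a) = a.1 :=
  (P.triv x₀).proj_symm_apply ((P.triv x₀).mem_target.2 ha)

theorem fiberCoord_localPoint {x₀ : P.base} {a : P.base × ℝˣ}
    (ha : a.1 ∈ (P.triv x₀).baseSet) : P.fiberCoord x₀ (P.localPoint x₀ a) = a.2 :=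
  congrArg Prod.snd ((P.triv x₀).apply_symm_apply ((P.triv x₀).mem_target.2 ha))

theorem eq_of_fiberCoord_eq {x₀ : P.base} {p p' : P.total} (hp : P.proj p ∈ (P.triv x₀).baseSet)
    (h : P.proj p = P.proj p') (h' : P.fiberCoord x₀ p = P.fiberCoord x₀ p') : p = p' := by
  have hs := (P.triv x₀).mem_source.2 hp
  have hs' := (P.triv x₀).mem_source.2 (h ▸ hp)
  refine (P.triv x₀).injOn hs hs' (Prod.ext ?_ h')
  exact ((P.triv x₀).coe_fst hs).trans (h.trans ((P.triv x₀).coe_fst hs').symm)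

/-- The point `p` is its `j`-coordinate times the point of `j`-coordinate `1`, and the
`i`-coordinate is equivariant. This is the source of the cocycle. -/
theorem fiberCoord_eq_mul {i j : P.base} {p : P.total} (hi : P.proj p ∈ (P.triv i).baseSet)
    (hj : P.proj p ∈ (P.triv j).baseSet) :
    P.fiberCoord i p = P.fiberCoord j p * P.fiberCoord i (P.localPoint j (P.proj p, 1)) := by
  have h1 := proj_localPoint (a := (P.proj p, 1)) hj
  have h : p = P.fiberCoord j p • P.localPoint j (P.proj p, 1) := by
    refine eq_of_fiberCoord_eq hj ?_ ?_
    · rw [P.proj_smul, h1]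
    · rw [fiberCoord_smul _ (by rwa [h1]), fiberCoord_localPoint (a := (P.proj p, 1)) hj, mul_one]
  conv_lhs => rw [h, fiberCoord_smul _ (by rwa [h1])]

theorem contMDiffAt_fiberCoord {x₀ : P.base} {p : P.total}
    (hp : P.proj p ∈ (P.triv x₀).baseSet) :
    ContMDiffAt P.total.I 𝓘(ℝ, ℝ) ∞ (fun p ↦ (P.fiberCoord x₀ p : ℝ)) p := by
  have h := (P.contMDiffOn_triv x₀).contMDiffAt
    ((P.triv x₀).open_source.mem_nhds ((P.triv x₀).mem_source.2 hp))
  exact Units.contMDiff_val.contMDiffAt.comp p (contMDiffAt_snd.comp p h)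

theorem contMDiffAt_localPoint {x₀ : P.base} {a : P.base × ℝˣ}
    (ha : a.1 ∈ (P.triv x₀).baseSet) :
    ContMDiffAt (P.base.I.prod 𝓘(ℝ, ℝ)) P.total.I ∞ (P.localPoint x₀) a :=
  (P.contMDiffOn_triv_symm x₀).contMDiffAt
    ((P.triv x₀).open_target.mem_nhds ((P.triv x₀).mem_target.2 ha))

variable (P)

/-- The transition coefficients of the line bundle dual to the one associated with `P`. -/
def transition (i j x : P.base) : ℝ := P.fiberCoord i (P.localPoint j (x, 1))

variable {P}

theorem contMDiffAt_transition {i j x : P.base} (hi : x ∈ (P.triv i).baseSet)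
    (hj : x ∈ (P.triv j).baseSet) : ContMDiffAt P.base.I 𝓘(ℝ, ℝ) ∞ (P.transition i j) x := by
  have h1 : ContMDiffAt P.base.I P.total.I ∞ (fun x ↦ P.localPoint j (x, 1)) x :=
    ContMDiffAt.comp (g := P.localPoint j) (f := fun x ↦ (x, 1)) x
      (contMDiffAt_localPoint (a := (x, 1)) hj) (contMDiffAt_id.prodMk contMDiffAt_const)
  exact ContMDiffAt.comp (g := fun p ↦ (P.fiberCoord i p : ℝ)) x (contMDiffAt_fiberCoord (by
    rwa [proj_localPoint (a := (x, 1)) hj])) h1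

theorem contMDiffOn_toSpanSingleton_transition (i j : P.base) :
    ContMDiffOn P.base.I 𝓘(ℝ, ℝ →L[ℝ] ℝ) ∞
      (fun x ↦ ContinuousLinearMap.toSpanSingleton ℝ (P.transition i j x))
      ((P.triv i).baseSet ∩ (P.triv j).baseSet) := fun x hx ↦ by
  have h : ContMDiffAt P.base.I 𝓘(ℝ, ℝ →L[ℝ] ℝ) ∞
      (fun x ↦ (ContinuousLinearMap.toSpanSingletonCLE (𝕜 := ℝ) (E := ℝ) : ℝ →L[ℝ] (ℝ →L[ℝ] ℝ))
        (P.transition i j x)) x :=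
    (ContinuousLinearMap.contMDiff _).contMDiffAt.comp x (contMDiffAt_transition hx.1 hx.2)
  exact h.contMDiffWithinAt

variable (P)

/-- The cocycle of the line bundle whose slit dual is `P`. -/
def lineCore : VectorBundleCore ℝ P.base ℝ P.base where
  baseSet i := (P.triv i).baseSet
  isOpen_baseSet i := (P.triv i).open_baseSet
  indexAt x := x
  mem_baseSet_at := P.mem_triv
  -- Points of `P` are to become covectors. Their coordinates satisfy `c_i = c_j τ_ij`, so vector
  -- coordinates must change by `v_j = v_i τ_ij`; then `c_i v_i = c_j v_j` is independent of the
  -- trivialization.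
  coordChange i j x := ContinuousLinearMap.toSpanSingleton ℝ (P.transition i j x)
  coordChange_self i x hx v := by
    rw [ContinuousLinearMap.toSpanSingleton_apply, transition,
      fiberCoord_localPoint (a := (x, 1)) hx, Units.val_one, smul_eq_mul, mul_one]
  continuousOn_coordChange i j := (contMDiffOn_toSpanSingleton_transition i j).continuousOn
  coordChange_comp i j k x hx v := by
    have h1 := proj_localPoint (a := (x, 1)) hx.2
    have h := fiberCoord_eq_mul (p := P.localPoint k (x, 1)) (i := i) (j := j)
      (by rw [h1]; exact hx.1.1) (by rw [h1]; exact hx.1.2)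
    rw [h1] at h
    simp only [ContinuousLinearMap.toSpanSingleton_apply, smul_eq_mul, transition]
    rw [h, Units.val_mul]
    ring

instance : P.lineCore.IsContMDiff P.base.I ∞ :=
  ⟨contMDiffOn_toSpanSingleton_transition⟩

/-- The line bundle whose slit dual is `P`. -/
abbrev line : LineBundle where
  base := P.base
  fiber := P.lineCore.Fiber

variable {P}

/-- The fibre over `x` is `ℝ` in the coordinate of the index `x` itself, so the frame at `x₀` is
read off through the change from `x₀` to `x`. -/
theorem lineFrame_line {x₀ x : P.base} (hx : x ∈ (P.triv x₀).baseSet) :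
    lineFrame P.line.fiber x₀ x = (P.transition x₀ x x : ℝ) := by
  have h := VectorBundleCore.localTriv_symm_apply P.lineCore (i := x₀) hx 1
  refine h.trans ?_
  change (1 : ℝ) • P.transition x₀ x x = _
  rw [one_smul]

variable (P)

/-- The covector on the fibre of `P.line` determined by a point of `P`. -/
def toCovector (p : P.total) : DualFiber P.line.fiber (P.proj p) :=
  (ContinuousLinearMap.toSpanSingleton ℝ (P.fiberCoord (P.proj p) p : ℝ) : ℝ →L[ℝ] ℝ)

theorem toCovector_apply (p : P.total) (v : ℝ) :
    P.toCovector p v = v * (P.fiberCoord (P.proj p) p : ℝ) := rfl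

theorem toCovector_ne_zero (p : P.total) : P.toCovector p ≠ 0 := fun h ↦ by
  have h1 : P.toCovector p (1 : ℝ) = (0 : ℝ) := DFunLike.congr_fun h (1 : ℝ)
  rw [toCovector_apply, one_mul] at h1
  exact (P.fiberCoord (P.proj p) p).ne_zero h1

/-- The identification of `P` with the slit dual of `P.line`, as a function. -/
def toSlit (p : P.total) : P.line.slitDual.total :=
  slitMk (L := P.line) (P.proj p) (P.toCovector p) (P.toCovector_ne_zero p)

variable {P}

/-- The two transition factors compensate, so `toSlit` is the identity in matching trivializations.
Smoothness, equivariance and bijectivity all come from this. -/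
theorem dualCoord_toSlit {x₀ : P.base} {p : P.total} (hp : P.proj p ∈ (P.triv x₀).baseSet) :
    dualCoord P.line.fiber x₀ (P.toSlit p : P.line.slit).1 = P.fiberCoord x₀ p := by
  have h : dualCoord P.line.fiber x₀ (P.toSlit p : P.line.slit).1 =
      P.toCovector p (P.transition x₀ (P.proj p) (P.proj p)) :=
    congrArg (P.toCovector p) (lineFrame_line hp)
  rw [h, toCovector_apply, fiberCoord_eq_mul hp (P.mem_triv (P.proj p)), Units.val_mul, mul_comm]
  rfl

theorem contMDiff_toSlit : ContMDiff P.total.I P.line.slitDual.total.I ∞ P.toSlit := by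
  intro p
  have hp := P.mem_triv (P.proj p)
  refine (contMDiffAt_slit_iff (L := P.line) (f := P.toSlit) (x₀ := P.proj p) hp).2
    ⟨P.contMDiff_proj.contMDiffAt, ?_⟩
  refine (contMDiffAt_fiberCoord hp).congr_of_eventuallyEq ?_
  filter_upwards [P.contMDiff_proj.continuous.continuousAt.preimage_mem_nhds
    ((P.triv (P.proj p)).open_baseSet.mem_nhds hp)] with p' hp'
  exact dualCoord_toSlit hp'

theorem toSlit_eq {x₀ : P.base} {p : P.total} {q : P.line.slit}
    (hp : P.proj p ∈ (P.triv x₀).baseSet) (h : P.proj p = q.1.1)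
    (h' : (P.fiberCoord x₀ p : ℝ) = dualCoord P.line.fiber x₀ q.1) : P.toSlit p = q :=
  slit_ext (L := P.line) (p := P.toSlit p) (x₀ := x₀) hp h ((dualCoord_toSlit hp).trans h')

theorem toSlit_smul (t : ℝˣ) (p : P.total) : P.toSlit (t • p) = t • P.toSlit p := by
  have hp := P.mem_triv (P.proj p)
  have hp' : P.proj (t • p) ∈ (P.triv (P.proj p)).baseSet := by rwa [P.proj_smul]
  refine toSlit_eq (q := (t • (P.toSlit p : P.line.slit) : P.line.slit)) hp' (P.proj_smul t p) ?_
  rw [fiberCoord_smul t hp, Units.val_mul]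
  exact congrArg ((t : ℝ) * ·) (dualCoord_toSlit hp).symm

theorem toSlit_injective : Function.Injective P.toSlit := by
  intro p p' h
  have hp := P.mem_triv (P.proj p)
  have h1 : P.proj p = P.proj p' := congrArg (fun q : P.line.slit ↦ q.1.1) h
  refine eq_of_fiberCoord_eq hp h1 (Units.ext ?_)
  rw [← dualCoord_toSlit hp, ← dualCoord_toSlit (h1 ▸ hp), h]

theorem toSlit_localPoint {x₀ : P.base} {q : P.line.slit}
    (hq : q.1.1 ∈ (P.triv x₀).baseSet) :
    P.toSlit (P.localPoint x₀ (q.1.1, slitFiberCoord (L := P.line) x₀ q)) = q := by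
  have h1 := proj_localPoint (a := (q.1.1, slitFiberCoord (L := P.line) x₀ q)) hq
  refine toSlit_eq (Set.mem_of_eq_of_mem h1 hq) h1 ?_
  rw [fiberCoord_localPoint (a := (q.1.1, slitFiberCoord (L := P.line) x₀ q)) hq]
  exact slitFiberCoord_val (L := P.line) hq

variable (P)

/-- The inverse of the identification of `P` with the slit dual of `P.line`. -/
def ofSlit (q : P.line.slitDual.total) : P.total :=
  P.localPoint (q : P.line.slit).1.1
    ((q : P.line.slit).1.1, slitFiberCoord (L := P.line) (q : P.line.slit).1.1 q)

variable {P}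

theorem toSlit_ofSlit (q : P.line.slitDual.total) : P.toSlit (P.ofSlit q) = q :=
  toSlit_localPoint (q := q) (P.mem_triv (q : P.line.slit).1.1)

theorem ofSlit_toSlit (p : P.total) : P.ofSlit (P.toSlit p) = p :=
  toSlit_injective (toSlit_ofSlit _)

/-- The definition of `ofSlit` uses a trivialization that moves with the base point; near a given
point a fixed one gives the same values, from which smoothness follows. -/
theorem ofSlit_eq {x₀ : P.base} {q : P.line.slit} (hq : q.1.1 ∈ (P.triv x₀).baseSet) :
    P.ofSlit q = P.localPoint x₀ (q.1.1, slitFiberCoord (L := P.line) x₀ q) :=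
  toSlit_injective ((toSlit_ofSlit q).trans (toSlit_localPoint hq).symm)

variable (P) in
/-- The local trivialization of the slit dual of `P.line` at a point. -/
def slitLocal (x₀ : P.base) (q : P.line.slitDual.total) : P.base × ℝˣ :=
  ((q : P.line.slit).1.1, slitFiberCoord (L := P.line) x₀ q)

theorem contMDiffAt_slitLocal {x₀ : P.base} {q : P.line.slitDual.total}
    (hq : (q : P.line.slit).1.1 ∈ (P.triv x₀).baseSet) :
    ContMDiffAt P.line.slitDual.total.I (P.base.I.prod 𝓘(ℝ, ℝ)) ∞ (P.slitLocal x₀) q :=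
  contMDiffAt_slitCoord (L := P.line) (x₀ := x₀) (q := q) hq

theorem contMDiff_ofSlit : ContMDiff P.line.slitDual.total.I P.total.I ∞ P.ofSlit := by
  intro q
  have hq : (q : P.line.slit).1.1 ∈ (P.triv (q : P.line.slit).1.1).baseSet := P.mem_triv _
  refine (ContMDiffAt.comp (g := P.localPoint (q : P.line.slit).1.1)
    (f := P.slitLocal (q : P.line.slit).1.1) q
    (contMDiffAt_localPoint (a := P.slitLocal (q : P.line.slit).1.1 q) hq)
    (contMDiffAt_slitLocal hq)).congr_of_eventuallyEq ?_
  filter_upwards [(slitProj (L := P.line)).contMDiff.continuous.continuousAt.preimage_mem_nhds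
    ((P.triv (q : P.line.slit).1.1).open_baseSet.mem_nhds hq)] with q' hq'
  exact ofSlit_eq (q := q') hq'

variable (P)

/-- The identification of a homogeneous manifold with a slit dual. -/
def homToSlit : Hom P P.line.slitDual where
  toMap := ⟨P.toSlit, contMDiff_toSlit⟩
  map_smul := toSlit_smul

/-- The identification of a slit dual with a given homogeneous manifold. -/
def homOfSlit : Hom P.line.slitDual P where
  toMap := ⟨P.ofSlit, contMDiff_ofSlit⟩
  map_smul t q := toSlit_injective ((toSlit_ofSlit (t • q)).trans
    ((congrArg (fun q : P.line.slitDual.total ↦ t • q) (toSlit_ofSlit q).symm).trans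
      (toSlit_smul t (P.ofSlit q)).symm))

theorem homToSlit_homOfSlit : P.homToSlit.comp P.homOfSlit = Hom.id _ :=
  Hom.ext (ContMDiffMap.ext toSlit_ofSlit)

theorem homOfSlit_homToSlit : P.homOfSlit.comp P.homToSlit = Hom.id _ :=
  Hom.ext (ContMDiffMap.ext ofSlit_toSlit)

end HomogeneousManifold

/-! ### Transport of Poisson brackets along equivariant isomorphisms -/

namespace PoissonBracket

open SmoothManifold

variable {P Q : HomogeneousManifold}

theorem pullback_pullback_of_comp_eq_id {Ψ : P.Hom Q} {Ψ' : Q.Hom P}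
    (h : Ψ'.comp Ψ = HomogeneousManifold.Hom.id P) (f : P.total.Fun) :
    pullback Ψ.toMap (pullback Ψ'.toMap f) = f :=
  congrArg (fun Φ ↦ pullback (HomogeneousManifold.Hom.toMap Φ) f) h

/-- The transport of a Poisson bracket along an invertible equivariant map. -/
def transport (b : PoissonBracket P.total) {Ψ : P.Hom Q} {Ψ' : Q.Hom P}
    (h : Ψ'.comp Ψ = HomogeneousManifold.Hom.id P) (h' : Ψ.comp Ψ' = HomogeneousManifold.Hom.id Q) :
    PoissonBracket Q.total where
  bracket := (b.bracket.compl₁₂ (pullbackLin Ψ.toMap) (pullbackLin Ψ.toMap)).compr₂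
    (pullbackLin Ψ'.toMap)
  bracket_self f := congrArg (pullback Ψ'.toMap) (b.bracket_self (pullback Ψ.toMap f))
  jacobi f g k := by
    change pullback Ψ'.toMap (b.bracket _ (pullback Ψ.toMap (pullback Ψ'.toMap _))) +
      pullback Ψ'.toMap (b.bracket _ (pullback Ψ.toMap (pullback Ψ'.toMap _))) +
      pullback Ψ'.toMap (b.bracket _ (pullback Ψ.toMap (pullback Ψ'.toMap _))) = 0
    rw [pullback_pullback_of_comp_eq_id h, pullback_pullback_of_comp_eq_id h,
      pullback_pullback_of_comp_eq_id h]
    exact congrArg (pullback Ψ'.toMap)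
      (b.jacobi (pullback Ψ.toMap f) (pullback Ψ.toMap g) (pullback Ψ.toMap k))
  leibniz_left f g k := by
    have h1 := congrArg (pullback Ψ'.toMap)
      (b.leibniz_left (pullback Ψ.toMap f) (pullback Ψ.toMap g) (pullback Ψ.toMap k))
    rw [pullback_add, pullback_mul, pullback_mul, pullback_pullback_of_comp_eq_id h',
      pullback_pullback_of_comp_eq_id h'] at h1
    exact h1
  leibniz_right f g k := by
    have h1 := congrArg (pullback Ψ'.toMap)
      (b.leibniz_right (pullback Ψ.toMap f) (pullback Ψ.toMap g) (pullback Ψ.toMap k))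
    rw [pullback_add, pullback_mul, pullback_mul, pullback_pullback_of_comp_eq_id h',
      pullback_pullback_of_comp_eq_id h'] at h1
    exact h1

section Transport

variable (b : PoissonBracket P.total) {Ψ : P.Hom Q} {Ψ' : Q.Hom P}
  (h : Ψ'.comp Ψ = HomogeneousManifold.Hom.id P) (h' : Ψ.comp Ψ' = HomogeneousManifold.Hom.id Q)

theorem transport_bracket (f g : Q.total.Fun) : (b.transport h h').bracket f g =
    pullback Ψ'.toMap (b.bracket (pullback Ψ.toMap f) (pullback Ψ.toMap g)) := rfl

theorem isPoissonMap_transport : IsPoissonMap Ψ.toMap b (b.transport h h') := fun f g ↦ by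
  rw [transport_bracket, pullback_pullback_of_comp_eq_id h]

theorem isPoissonMap_transport_symm : IsPoissonMap Ψ'.toMap (b.transport h h') b := fun f g ↦ by
  rw [transport_bracket, pullback_pullback_of_comp_eq_id h, pullback_pullback_of_comp_eq_id h]

theorem _root_.HomogeneousManifold.Hom.pullback_h (Φ : P.Hom Q) (t : ℝˣ) (f : Q.total.Fun) :
    pullback (P.h t) (pullback Φ.toMap f) = pullback Φ.toMap (pullback (Q.h t) f) :=
  ContMDiffMap.ext fun p ↦ congrArg f (Φ.map_smul t p)

theorem IsHomogeneous.transport {b : PoissonBracket P.total} (hb : b.IsHomogeneous) :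
    (b.transport h h').IsHomogeneous := fun t f g ↦ by
  rw [transport_bracket, HomogeneousManifold.Hom.pullback_h, hb, pullback_smul,
    HomogeneousManifold.Hom.pullback_h, HomogeneousManifold.Hom.pullback_h]
  rfl

end Transport

end PoissonBracket

/-! ### The equivalence of categories -/

section Equivalence

open SmoothManifold

theorem poissonizationEquiv_isPoissonization (L : LineBundle) (J : JacobiBracket L) :
    IsPoissonization J (poissonizationEquiv L J).1 := J.isPoissonization_poissonization

theorem isPoissonMap_poissonizationEquiv (A B : JacobiManifold) (F : A ⟶ B) :
    IsPoissonMap (LineBundle.slitDualMap F.1).toMap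
      (poissonizationEquiv A.line A.jacobi).1 (poissonizationEquiv B.line B.jacobi).1 :=
  (poissonizationEquiv_isPoissonization _ _).isPoissonMap
    (poissonizationEquiv_isPoissonization _ _) F.2

/-- The functor sending a Jacobi manifold to its homogeneous Poisson manifold. -/
abbrev jacobiToPoisson : CategoryTheory.Functor JacobiManifold HomogeneousPoissonManifold :=
  poissonizationFunctor (fun L ↦ poissonizationEquiv L) isPoissonMap_poissonizationEquiv

instance : jacobiToPoisson.Faithful where
  map_injective h := Subtype.ext (LineBundle.slitDualMap_injective (congrArg Subtype.val h))

/-- An equivariant Poisson map comes from a line bundle map; this is Jacobi because the Poisson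
condition on lifts descends to sections by injectivity of `lift`. -/
instance : jacobiToPoisson.Full where
  map_surjective {A B} Ψ := by
    have hF := LineBundle.slitDualMap_ofSlitDual Ψ.1
    refine ⟨⟨LineBundle.Hom.ofSlitDual Ψ.1, ?_⟩, Subtype.ext hF⟩
    refine (poissonizationEquiv_isPoissonization _ A.jacobi).isJacobi
      (poissonizationEquiv_isPoissonization _ B.jacobi) ?_
    rw [hF]
    exact Ψ.2

/-- The bracket transported to the slit dual of `P.line` remains homogeneous, hence arises from a
Jacobi bracket, and the identification is a Poisson map in both directions. -/
instance : jacobiToPoisson.EssSurj where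
  mem_essImage Y := by
    have h := Y.manifold.homOfSlit_homToSlit
    have h' := Y.manifold.homToSlit_homOfSlit
    let b' : {b : PoissonBracket Y.manifold.line.slitDual.total // b.IsHomogeneous} :=
      ⟨Y.poisson.transport h h', Y.isHomogeneous.transport h h'⟩
    have hb' := (poissonizationEquiv Y.manifold.line).apply_symm_apply b'
    refine ⟨⟨Y.manifold.line, (poissonizationEquiv Y.manifold.line).symm b'⟩, ⟨?_⟩⟩
    refine ⟨⟨Y.manifold.homOfSlit, ?_⟩, ⟨Y.manifold.homToSlit, ?_⟩, Subtype.ext h',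
      Subtype.ext h⟩
    · change IsPoissonMap _ (poissonizationEquiv Y.manifold.line _).1 _
      rw [hb']
      exact Y.poisson.isPoissonMap_transport_symm h h'
    · change IsPoissonMap _ _ (poissonizationEquiv Y.manifold.line _).1
      rw [hb']
      exact Y.poisson.isPoissonMap_transport h h'

end Equivalence

end

theorem mainTheorem3 :
    ∃ Φ : ∀ L : LineBundle, JacobiBracket L ≃ {b : PoissonBracket L.slitDual.total //
        b.IsHomogeneous},
      (∀ (L : LineBundle) (J : JacobiBracket L) (b : PoissonBracket L.slitDual.total),
        IsPoissonization J b ↔ b = (Φ L J).1) ∧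
      ∃ hΦ : ∀ (A B : JacobiManifold) (F : A ⟶ B), SmoothManifold.IsPoissonMap
          (LineBundle.slitDualMap F.1).toMap (Φ A.line A.jacobi).1 (Φ B.line B.jacobi).1,
        (poissonizationFunctor (fun L ↦ Φ L) hΦ).IsEquivalence := by
  refine ⟨poissonizationEquiv, fun L J b ↦ ⟨fun h ↦ h.unique
    (poissonizationEquiv_isPoissonization L J), ?_⟩, isPoissonMap_poissonizationEquiv, ?_⟩
  · rintro rfl
    exact poissonizationEquiv_isPoissonization L J
  · have : jacobiToPoisson.IsEquivalence := {}
    exact this
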